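/- Let $S$ be an inverse semigroup with zero $0$, ordered by $a\le b \iff a=eb$ for some idempotent $e$; joins $\vee$ and meets $\wedge$ refer to this order. Write $a\perp b$ if $a\wedge b=0$. Define relations on $S$ as follows. - $a\prec b$ iff $a\le b$ and for every $c\ge b$ there is $a'\perp a$ such that $\{a',b\}$ is bounded above and $c\le d$ for every $d\ge a',b$. - $a\prec\!\!\prec b$ iff $a\le b$ and $a^{-1}a\prec b^{-1}b$. - $a\smallsmile b$ iff for all $a'\prec a$ and $b'\prec b$ there is $c\prec a,b$ such that $c'\prec c$ for all $c'\prec a',b'$. - $a\sim b$ iff $ab^{-1}$ and $a^{-1}b$ are idempotent. - $a\simeq b$ iff $a\sim b$ and $a\smallsmile b$. $S$ is *$\prec$-distributive* if, whenever $b\vee c$ exists, for all $a$: $a\le b\vee c$ holds iff for every $a'\prec a$ there are $b'\prec b$ and $c'\prec c$ such that $b'\vee c'$ exists and $a'\prec b'\vee c'\prec a$. $S$ is a *basic semigroup* if (1) every $a\in S$ satisfies $a\prec\!\!\prec b$ for some $b\in S$, (2) $S$ is $\prec$-distributive, and (3) $a\vee b$ exists whenever $a$ and $b$ have a common upper bound.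 $S$ is a *$\simeq$-basic semigroup* if it is $\prec$-distributive and, for all $a,b\in S$, $a\vee b$ exists iff there are $a',b'\in S$ with $a\prec\!\!\prec a'\simeq b'$ and $b\prec\!\!\prec b'$. For a transitive relation $<$, a *$<$-filter* is a non-empty $U\subseteq S$ such that $v>u\in U$ implies $v\in U$, and for all $u,v\in U$ there is $w\in U$ with $w<u$ and $w<v$. A *$<$-ultrafilter* is a maximal $<$-filter among those different from $S$. For $A\subseteq S$ let $A^{\le}$ be its upward closure in $S$. The *Lenz groupoid* of $S$ is the set of $\le$-filters (every $\prec$-filter is one), with inverse $U^{-1}=\{u^{-1}:u\in U\}$ and with product $U\cdot V=(UV)^{\le}$ defined exactly when $(U^{-1}U)^{\le}=(VV^{-1})^{\le}$. Let $G$ be the set of $\prec$-ultrafilters of $S$, with the topology generated by the sets $O_a=\{U\in G: a\in U\}$, $a\in S$. **Theorem.** Let $S$ be a basic semigroup. Then $G$ is a subgroupoid of the Lenz groupoid of $S$ (closed under inverses and all defined products). As a space, $G$ is locally compact (every point has a neighbourhood base of compact sets) and locally Hausdorff (every point has a Hausdorff neighbourhood). With these operations $G$ is an étale groupoid: inversion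 and multiplication are continuous and $g\mapsto g^{-1}g$ is a local homeomorphism. For all $a,b\in S$, $$O_a^{-1}=O_{a^{-1}},\qquad O_{ab}=O_a\cdot O_b,$$ where $O_a\cdot O_b$ is the set of all defined products. Moreover, if $S$ is a $\simeq$-basic semigroup, then $\mathcal B=\{O_a:a\in S\}$ is a *$\cup$-étale basis* of $G$: it is a basis of the topology, $O^{-1}\in\mathcal B$ and $O\cdot N\in\mathcal B$ for all $O,N\in\mathcal B$, and for all $O,N\in\mathcal B$ $$O\cup N\in\mathcal B\iff O\cup N\subseteq B\text{ for some compact bi-Hausdorff bisection }B\subseteq G.$$ Here $B$ is a *bisection* if $B^{-1}\cdot B$ and $B\cdot B^{-1}$ consist of units, and *bi-Hausdorff* if $B^{-1}\cdot B$ and $B\cdot B^{-1}$ are Hausdorff, where a subset of $G$ is called Hausdorff if any two distinct points of it have disjoint neighbourhoods in $G$. -/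

import Mathlib

open Set Topology

namespace UltrafilterGroupoid

/-! ### Order theory: posets with a minimum -/

section Poset

variable {P : Type*} [PartialOrder P] [OrderBot P]

/-- The rather below relation `a ≺ b`. (`Disjoint a a'` says that the meet of `a` and `a'` is the
minimum.) -/
def RatherBelow (a b : P) : Prop :=
  a ≤ b ∧ ∀ c, b ≤ c → ∃ a', Disjoint a' a ∧
    (∃ d, a' ≤ d ∧ b ≤ d) ∧ ∀ d, a' ≤ d → b ≤ d → c ≤ d

/-- The Hausdorff relation `a ⌣ b`, defined from the rather below relation. -/
def HausdorffRel (a b : P) : Prop :=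
  ∀ a', RatherBelow a' a → ∀ b', RatherBelow b' b →
    ∃ c, RatherBelow c a ∧ RatherBelow c b ∧
      ∀ c', RatherBelow c' a' → RatherBelow c' b' → RatherBelow c' c

variable (P) in
/-- `P` is `≺`-distributive: whenever `j = b ∨ c` exists, `a ≤ b ∨ c` holds if and only if for all
`a' ≺ a` there are `b' ≺ b` and `c' ≺ c` with `a' ≺ b' ∨ c' ≺ a`. -/
def PrecDistributive : Prop :=
  ∀ a b c j : P, IsLUB {b, c} j →
    (a ≤ j ↔ ∀ a', RatherBelow a' a → ∃ b' c' j', RatherBelow b' b ∧ RatherBelow c' c ∧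
      IsLUB {b', c'} j' ∧ RatherBelow a' j' ∧ RatherBelow j' a)

variable (P) in
/-- Bounded pairs have joins. -/
def ConditionalJoinSemilattice : Prop :=
  ∀ a b c : P, a ≤ c → b ≤ c → ∃ j, IsLUB {a, b} j

end Poset

/-- A (non-empty) filter with respect to a relation `r` on `P`. -/
structure IsRelFilter {P : Type*} (r : P → P → Prop) (U : Set P) : Prop where
  nonempty : U.Nonempty
  closed : ∀ ⦃u v⦄, u ∈ U → r u v → v ∈ U
  directed : ∀ ⦃u v⦄, u ∈ U → v ∈ U → ∃ w ∈ U, r w u ∧ r w v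

/-- A maximal proper filter with respect to a relation `r`. -/
def IsRelUltrafilter {P : Type*} (r : P → P → Prop) (U : Set P) : Prop :=
  Maximal (fun V : Set P => IsRelFilter r V ∧ V ≠ univ) U

/-! ### Inverse semigroups -/

/-- An inverse semigroup: every `a` has a unique generalized inverse `a⁻¹`. -/
class InverseSemigroup (S : Type*) extends Semigroup S, Inv S where
  mul_inv_mul (a : S) : a * a⁻¹ * a = a
  inv_mul_inv (a : S) : a⁻¹ * a * a⁻¹ = a⁻¹
  inv_unique (a b : S) : a * b * a = a → b * a * b = b → b = a⁻¹

/-- An inverse semigroup with an absorbing zero. -/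
class InverseSemigroupWithZero (S : Type*) extends InverseSemigroup S, SemigroupWithZero S

namespace InverseSemigroup

variable {S : Type*} [InverseSemigroup S]

theorem mul_inv_mul' (a : S) : a * (a⁻¹ * a) = a := by
  rw [← mul_assoc, mul_inv_mul]

theorem inv_mul_inv' (a : S) : a⁻¹ * (a * a⁻¹) = a⁻¹ := by
  rw [← mul_assoc, inv_mul_inv]

protected theorem inv_inv (a : S) : a⁻¹⁻¹ = a :=
  (inv_unique a⁻¹ a (inv_mul_inv a) (mul_inv_mul a)).symm

theorem idem_inv {e : S} (he : e * e = e) : e⁻¹ = e :=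
  (inv_unique e e (by rw [he, he]) (by rw [he, he])).symm

theorem idem_mul_idem {e f : S} (he : e * e = e) (hf : f * f = f) :
    (e * f) * (e * f) = e * f := by
  have h1 : f * (e * f)⁻¹ * e = (e * f)⁻¹ := by
    apply inv_unique
    · calc e * f * (f * (e * f)⁻¹ * e) * (e * f)
          = e * (f * f) * (e * f)⁻¹ * ((e * e) * f) := by simp only [mul_assoc]
        _ = e * f := by rw [he, hf, mul_inv_mul]
    · calc f * (e * f)⁻¹ * e * (e * f) * (f * (e * f)⁻¹ * e)
          = f * ((e * f)⁻¹ * ((e * e) * (f * f)) * (e * f)⁻¹) * e := by simp only [mul_assoc]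
        _ = f * (e * f)⁻¹ * e := by rw [he, hf, inv_mul_inv]
  have h2 : (e * f)⁻¹ * (e * f)⁻¹ = (e * f)⁻¹ := by
    calc (e * f)⁻¹ * (e * f)⁻¹ = (f * (e * f)⁻¹ * e) * (f * (e * f)⁻¹ * e) := by rw [h1]
      _ = f * ((e * f)⁻¹ * (e * f) * (e * f)⁻¹) * e := by simp only [mul_assoc]
      _ = (e * f)⁻¹ := by rw [inv_mul_inv, h1]
  have h3 := idem_inv h2
  rw [InverseSemigroup.inv_inv] at h3
  rw [← h3] at h2
  exact h2

theorem idem_comm {e f : S} (he : e * e = e) (hf : f * f = f) : e * f = f * e := by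
  have h1 := idem_mul_idem he hf
  have h2 := idem_mul_idem hf he
  have h : f * e = (e * f)⁻¹ := by
    apply inv_unique
    · calc e * f * (f * e) * (e * f) = e * (f * f) * ((e * e) * f) := by simp only [mul_assoc]
        _ = e * f := by rw [he, hf, h1]
    · calc f * e * (e * f) * (f * e) = f * (e * e) * ((f * f) * e) := by simp only [mul_assoc]
        _ = f * e := by rw [he, hf, h2]
  rw [h, idem_inv h1]

theorem mul_inv_idem (a : S) : (a * a⁻¹) * (a * a⁻¹) = a * a⁻¹ := by
  rw [← mul_assoc, mul_inv_mul]

theorem inv_mul_idem (a : S) : (a⁻¹ * a) * (a⁻¹ * a) = a⁻¹ * a := by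
  rw [← mul_assoc, inv_mul_inv]

protected theorem mul_inv_rev (a b : S) : (a * b)⁻¹ = b⁻¹ * a⁻¹ := by
  symm
  have hc := idem_comm (mul_inv_idem b) (inv_mul_idem a)
  apply inv_unique
  · calc a * b * (b⁻¹ * a⁻¹) * (a * b) = a * ((b * b⁻¹) * (a⁻¹ * a)) * b := by
          simp only [mul_assoc]
      _ = (a * a⁻¹ * a) * (b * b⁻¹ * b) := by rw [hc]; simp only [mul_assoc]
      _ = a * b := by rw [mul_inv_mul, mul_inv_mul]
  · calc b⁻¹ * a⁻¹ * (a * b) * (b⁻¹ * a⁻¹) = b⁻¹ * ((a⁻¹ * a) * (b * b⁻¹)) * a⁻¹ := by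
          simp only [mul_assoc]
      _ = (b⁻¹ * b * b⁻¹) * (a⁻¹ * a * a⁻¹) := by rw [← hc]; simp only [mul_assoc]
      _ = b⁻¹ * a⁻¹ := by rw [inv_mul_inv, inv_mul_inv]

theorem conj_idem {e : S} (he : e * e = e) (a : S) :
    (a * e * a⁻¹) * (a * e * a⁻¹) = a * e * a⁻¹ := by
  calc (a * e * a⁻¹) * (a * e * a⁻¹) = a * (e * (a⁻¹ * a)) * (e * a⁻¹) := by
        simp only [mul_assoc]
    _ = (a * a⁻¹ * a) * (e * e) * a⁻¹ := by
        rw [idem_comm he (inv_mul_idem a)]; simp only [mul_assoc]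
    _ = a * e * a⁻¹ := by rw [he, mul_inv_mul]

/-- Moving an idempotent past an element. -/
theorem mul_idem {e : S} (he : e * e = e) (a : S) : a * e = (a * e * a⁻¹) * a := by
  calc a * e = a * ((a⁻¹ * a) * e) := by rw [← mul_assoc, mul_inv_mul']
    _ = a * (e * (a⁻¹ * a)) := by rw [idem_comm he (inv_mul_idem a)]
    _ = (a * e * a⁻¹) * a := by simp only [mul_assoc]

/-- The canonical order: `a ≤ b` if and only if `a = e * b` for some idempotent `e`. -/
instance : PartialOrder S where
  le a b := ∃ e, e * e = e ∧ a = e * b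
  le_refl a := ⟨a * a⁻¹, mul_inv_idem a, (mul_inv_mul a).symm⟩
  le_trans := by
    rintro a b c ⟨e, he, rfl⟩ ⟨f, hf, rfl⟩
    exact ⟨e * f, idem_mul_idem he hf, (mul_assoc _ _ _).symm⟩
  le_antisymm := by
    rintro a b ⟨e, he, hab⟩ ⟨f, hf, hba⟩
    have h1 : e * a = a := by rw [hab, ← mul_assoc, he]
    calc a = e * b := hab
      _ = (e * f) * a := by rw [mul_assoc, ← hba]
      _ = f * (e * a) := by rw [idem_comm he hf, mul_assoc]
      _ = b := by rw [h1, ← hba]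

theorem le_def {a b : S} : a ≤ b ↔ ∃ e, e * e = e ∧ a = e * b := Iff.rfl

theorem inv_le_inv' {a b : S} (h : a ≤ b) : a⁻¹ ≤ b⁻¹ := by
  obtain ⟨e, he, rfl⟩ := h
  rw [InverseSemigroup.mul_inv_rev, idem_inv he, mul_idem he]
  exact ⟨_, conj_idem he _, rfl⟩

theorem mul_le_mul'' {a b c d : S} (h : a ≤ b) (h' : c ≤ d) : a * c ≤ b * d := by
  obtain ⟨e, he, rfl⟩ := h
  obtain ⟨f, hf, rfl⟩ := h'
  refine ⟨e * (b * f * b⁻¹), idem_mul_idem he (conj_idem hf b), ?_⟩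
  calc e * b * (f * d) = e * (b * f) * d := by simp only [mul_assoc]
    _ = e * (b * f * b⁻¹ * b) * d := by rw [← mul_idem hf b]
    _ = e * (b * f * b⁻¹) * (b * d) := by simp only [mul_assoc]

end InverseSemigroup

section WithZero

variable {S : Type*} [InverseSemigroupWithZero S]

/-- The zero is the minimum of the canonical order. -/
instance : OrderBot S where
  bot := 0
  bot_le a := ⟨0, zero_mul 0, (zero_mul a).symm⟩

/-- The relation `≺≺`. -/
def BiBelow (a b : S) : Prop :=
  RatherBelow (a⁻¹ * a) (b⁻¹ * b) ∧ a ≤ b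

/-- The compatibility relation `a ∼ b`: both `a * b⁻¹` and `a⁻¹ * b` are idempotents. -/
def Compatible (a b : S) : Prop :=
  IsIdempotentElem (a * b⁻¹) ∧ IsIdempotentElem (a⁻¹ * b)

/-- The relation `≃`, the conjunction of `∼` and `⌣`. -/
def SimeqRel (a b : S) : Prop :=
  Compatible a b ∧ HausdorffRel a b

variable (S) in
/-- Basic semigroups. -/
structure IsBasicSemigroup : Prop where
  round : ∀ a : S, ∃ b, BiBelow a b
  distributive : PrecDistributive S
  joins : ConditionalJoinSemilattice S

variable (S) in
/-- `≃`-basic semigroups. -/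
structure IsSimeqBasicSemigroup : Prop where
  distributive : PrecDistributive S
  joins : ∀ a b : S, (∃ j, IsLUB {a, b} j) ↔
    ∃ a' b', BiBelow a a' ∧ SimeqRel a' b' ∧ BiBelow b b'

end WithZero

/-! ### Groupoids, presented by their arrows -/

/-- A groupoid structure on a set `G` of arrows, i.e. a partial multiplication turning `G` into a
small category (whose objects are identified with the identity arrows) in which every arrow is
invertible. The product of `g` and `h` is defined exactly when `src g = tgt h`. -/
structure ArrowGroupoid (G : Type*) where
  src : G → G
  tgt : G → G
  mul : ∀ g h, src g = tgt h → G
  inv : G → G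
  src_src : ∀ g, src (src g) = src g
  tgt_src : ∀ g, tgt (src g) = src g
  src_tgt : ∀ g, src (tgt g) = tgt g
  tgt_tgt : ∀ g, tgt (tgt g) = tgt g
  src_mul : ∀ g h (H : src g = tgt h), src (mul g h H) = src h
  tgt_mul : ∀ g h (H : src g = tgt h), tgt (mul g h H) = tgt g
  mul_src : ∀ g, mul g (src g) (tgt_src g).symm = g
  tgt_mul_self : ∀ g, mul (tgt g) g (src_tgt g) = g
  assoc : ∀ g h k (H : src g = tgt h) (K : src h = tgt k),
    mul (mul g h H) k ((src_mul g h H).trans K) = mul g (mul h k K) (H.trans (tgt_mul h k K).symm)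
  src_inv : ∀ g, src (inv g) = tgt g
  tgt_inv : ∀ g, tgt (inv g) = src g
  inv_mul : ∀ g, mul (inv g) g (src_inv g) = src g
  mul_inv : ∀ g, mul g (inv g) (tgt_inv g).symm = tgt g

/-- A subset of a topological space is Hausdorff (in the space) if any two of its points have
disjoint neighbourhoods in the space. -/
def IsHausdorffSet {X : Type*} [TopologicalSpace X] (B : Set X) : Prop :=
  ∀ x ∈ B, ∀ y ∈ B, x ≠ y → ∃ U V : Set X, IsOpen U ∧ IsOpen V ∧ x ∈ U ∧ y ∈ V ∧ Disjoint U V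

/-- Every point has a Hausdorff neighbourhood. -/
def LocallyHausdorff (X : Type*) [TopologicalSpace X] : Prop :=
  ∀ x : X, ∃ N ∈ 𝓝 x, IsHausdorffSet N

namespace ArrowGroupoid

variable {G : Type*} (Γ : ArrowGroupoid G)

/-- A subset that is closed under inverses and under all defined products. -/
structure IsSubgroupoid (A : Set G) : Prop where
  inv_mem : ∀ g ∈ A, Γ.inv g ∈ A
  mul_mem : ∀ g ∈ A, ∀ h ∈ A, ∀ H : Γ.src g = Γ.tgt h, Γ.mul g h H ∈ A

theorem IsSubgroupoid.src_mem {Γ : ArrowGroupoid G} {A : Set G} (hA : Γ.IsSubgroupoid A)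
    {g : G} (hg : g ∈ A) : Γ.src g ∈ A := by
  rw [← Γ.inv_mul g]
  exact hA.mul_mem _ (hA.inv_mem g hg) _ hg _

theorem IsSubgroupoid.tgt_mem {Γ : ArrowGroupoid G} {A : Set G} (hA : Γ.IsSubgroupoid A)
    {g : G} (hg : g ∈ A) : Γ.tgt g ∈ A := by
  rw [← Γ.mul_inv g]
  exact hA.mul_mem _ hg _ (hA.inv_mem g hg) _

/-- The groupoid structure that a subgroupoid inherits. -/
def restrict (A : Set G) (hA : Γ.IsSubgroupoid A) : ArrowGroupoid A where
  src g := ⟨Γ.src g, hA.src_mem g.2⟩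
  tgt g := ⟨Γ.tgt g, hA.tgt_mem g.2⟩
  mul g h H := ⟨Γ.mul g h (congrArg Subtype.val H), hA.mul_mem _ g.2 _ h.2 _⟩
  inv g := ⟨Γ.inv g, hA.inv_mem _ g.2⟩
  src_src g := Subtype.ext (Γ.src_src g)
  tgt_src g := Subtype.ext (Γ.tgt_src g)
  src_tgt g := Subtype.ext (Γ.src_tgt g)
  tgt_tgt g := Subtype.ext (Γ.tgt_tgt g)
  src_mul g h _ := Subtype.ext (Γ.src_mul g h _)
  tgt_mul g h _ := Subtype.ext (Γ.tgt_mul g h _)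
  mul_src g := Subtype.ext (Γ.mul_src g)
  tgt_mul_self g := Subtype.ext (Γ.tgt_mul_self g)
  assoc g h k _ _ := Subtype.ext (Γ.assoc g h k _ _)
  src_inv g := Subtype.ext (Γ.src_inv g)
  tgt_inv g := Subtype.ext (Γ.tgt_inv g)
  inv_mul g := Subtype.ext (Γ.inv_mul g)
  mul_inv g := Subtype.ext (Γ.mul_inv g)

/-- The unit space. -/
def units : Set G := range Γ.src

/-- The set of inverses of the elements of `A`. -/
def setInv (A : Set G) : Set G := Γ.inv '' A

/-- The set of all defined products of an element of `A` and an element of `B`. -/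
def setMul (A B : Set G) : Set G :=
  {k | ∃ g ∈ A, ∃ h ∈ B, ∃ H : Γ.src g = Γ.tgt h, Γ.mul g h H = k}

/-- `B` is a bisection. -/
def IsBisection (B : Set G) : Prop :=
  Γ.setMul (Γ.setInv B) B ⊆ Γ.units ∧ Γ.setMul B (Γ.setInv B) ⊆ Γ.units

variable [TopologicalSpace G]

/-- `B` is bi-Hausdorff. -/
def IsBiHausdorff (B : Set G) : Prop :=
  IsHausdorffSet (Γ.setMul (Γ.setInv B) B) ∧ IsHausdorffSet (Γ.setMul B (Γ.setInv B))

/-- The inverse and the multiplication (on the space of composable pairs) are continuous. -/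
structure IsTopological : Prop where
  continuous_inv : Continuous Γ.inv
  continuous_mul : Continuous fun p : {p : G × G // Γ.src p.1 = Γ.tgt p.2} =>
    Γ.mul p.1.1 p.1.2 p.2

/-- An étale groupoid: a topological groupoid for which `g ↦ g⁻¹g` is a local homeomorphism. -/
structure IsEtale : Prop extends Γ.IsTopological where
  isLocalHomeomorph_src : IsLocalHomeomorph Γ.src

/-- A `∪`-étale basis. -/
structure IsUnionEtaleBasis (B : Set (Set G)) : Prop where
  isBasis : TopologicalSpace.IsTopologicalBasis B
  inv_mem : ∀ O ∈ B, Γ.setInv O ∈ B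
  mul_mem : ∀ O ∈ B, ∀ N ∈ B, Γ.setMul O N ∈ B
  union_mem_iff : ∀ O ∈ B, ∀ N ∈ B, (O ∪ N ∈ B ↔
    ∃ C : Set G, IsCompact C ∧ Γ.IsBiHausdorff C ∧ Γ.IsBisection C ∧ O ∪ N ⊆ C)

end ArrowGroupoid

/-! ### The Lenz groupoid -/

/-- The `≤`-filters of an inverse semigroup. -/
@[ext] structure LeFilter (S : Type*) [InverseSemigroup S] where
  carrier : Set S
  isFilter : IsRelFilter (fun a b : S => a ≤ b) carrier

namespace LeFilter

open InverseSemigroup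

variable {S : Type*} [InverseSemigroup S]

/-- `T · U`, the upward closure of the set of all products `t * u`. -/
def prod (T U : LeFilter S) : LeFilter S where
  carrier := {c | ∃ t ∈ T.carrier, ∃ u ∈ U.carrier, t * u ≤ c}
  isFilter := by
    refine ⟨?_, ?_, ?_⟩
    · obtain ⟨t, ht⟩ := T.isFilter.nonempty
      obtain ⟨u, hu⟩ := U.isFilter.nonempty
      exact ⟨t * u, t, ht, u, hu, le_rfl⟩
    · rintro c d ⟨t, ht, u, hu, h⟩ hcd
      exact ⟨t, ht, u, hu, h.trans hcd⟩
    · rintro c d ⟨t, ht, u, hu, h⟩ ⟨t', ht', u', hu', h'⟩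
      obtain ⟨x, hx, hx1, hx2⟩ := T.isFilter.directed ht ht'
      obtain ⟨y, hy, hy1, hy2⟩ := U.isFilter.directed hu hu'
      exact ⟨x * y, ⟨x, hx, y, hy, le_rfl⟩, (mul_le_mul'' hx1 hy1).trans h,
        (mul_le_mul'' hx2 hy2).trans h'⟩

/-- `U⁻¹`, the set of all inverses of elements of `U`. -/
def inverse (U : LeFilter S) : LeFilter S where
  carrier := {a | a⁻¹ ∈ U.carrier}
  isFilter := by
    refine ⟨?_, ?_, ?_⟩
    · obtain ⟨u, hu⟩ := U.isFilter.nonempty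
      exact ⟨u⁻¹, by simpa [InverseSemigroup.inv_inv] using hu⟩
    · intro c d hc hcd
      exact U.isFilter.closed hc (inv_le_inv' hcd)
    · intro c d hc hd
      obtain ⟨x, hx, hx1, hx2⟩ := U.isFilter.directed hc hd
      refine ⟨x⁻¹, by simpa [InverseSemigroup.inv_inv] using hx, ?_, ?_⟩
      · simpa [InverseSemigroup.inv_inv] using inv_le_inv' hx1
      · simpa [InverseSemigroup.inv_inv] using inv_le_inv' hx2

theorem mem_prod {T U : LeFilter S} {c : S} :
    c ∈ (T.prod U).carrier ↔ ∃ t ∈ T.carrier, ∃ u ∈ U.carrier, t * u ≤ c := Iff.rfl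

theorem mem_inverse {U : LeFilter S} {a : S} :
    a ∈ U.inverse.carrier ↔ a⁻¹ ∈ U.carrier := Iff.rfl

theorem prod_assoc (T U V : LeFilter S) : (T.prod U).prod V = T.prod (U.prod V) := by
  ext c
  simp only [mem_prod]
  constructor
  · rintro ⟨x, ⟨t, ht, u, hu, hx⟩, v, hv, hc⟩
    refine ⟨t, ht, u * v, ⟨u, hu, v, hv, le_rfl⟩, ?_⟩
    rw [← mul_assoc]
    exact (mul_le_mul'' hx le_rfl).trans hc
  · rintro ⟨t, ht, x, ⟨u, hu, v, hv, hx⟩, hc⟩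
    refine ⟨t * u, ⟨t, ht, u, hu, le_rfl⟩, v, hv, ?_⟩
    rw [mul_assoc]
    exact (mul_le_mul'' le_rfl hx).trans hc

theorem inverse_inverse (U : LeFilter S) : U.inverse.inverse = U := by
  ext c
  simp only [mem_inverse, InverseSemigroup.inv_inv]

theorem inverse_prod (T U : LeFilter S) : (T.prod U).inverse = U.inverse.prod T.inverse := by
  ext c
  simp only [mem_prod, mem_inverse]
  constructor
  · rintro ⟨t, ht, u, hu, hc⟩
    refine ⟨u⁻¹, by rwa [InverseSemigroup.inv_inv], t⁻¹, by rwa [InverseSemigroup.inv_inv], ?_⟩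
    simpa only [InverseSemigroup.inv_inv, InverseSemigroup.mul_inv_rev] using inv_le_inv' hc
  · rintro ⟨u, hu, t, ht, hc⟩
    refine ⟨t⁻¹, ht, u⁻¹, hu, ?_⟩
    simpa only [InverseSemigroup.mul_inv_rev] using inv_le_inv' hc

theorem prod_inverse_prod (U : LeFilter S) : U.prod (U.inverse.prod U) = U := by
  ext c
  simp only [mem_prod, mem_inverse]
  constructor
  · rintro ⟨t, ht, x, ⟨u, hu, v, hv, hx⟩, hc⟩
    obtain ⟨p, hp, hp1, hp2⟩ := U.isFilter.directed ht hu
    obtain ⟨q, hq, hq1, hq2⟩ := U.isFilter.directed hp hv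
    refine U.isFilter.closed hq (le_trans ?_ hc)
    have h1 : q⁻¹ ≤ u := by
      simpa only [InverseSemigroup.inv_inv] using inv_le_inv' (hq1.trans hp2)
    calc q = q * (q⁻¹ * q) := (mul_inv_mul' q).symm
      _ ≤ t * (u * v) := mul_le_mul'' (hq1.trans hp1) (mul_le_mul'' h1 hq2)
      _ ≤ t * x := mul_le_mul'' le_rfl hx
  · intro hc
    exact ⟨c, hc, c⁻¹ * c, ⟨c⁻¹, by rwa [InverseSemigroup.inv_inv], c, hc, le_rfl⟩,
      (mul_inv_mul' c).le⟩

theorem inverse_prod_inverse (U : LeFilter S) :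
    U.inverse.prod (U.prod U.inverse) = U.inverse := by
  have h := prod_inverse_prod U.inverse
  rwa [inverse_inverse] at h

end LeFilter

open LeFilter in
/-- The Lenz groupoid: the `≤`-filters, with `T · U` defined when `T⁻¹ · T = U · U⁻¹`. -/
def lenzGroupoid (S : Type*) [InverseSemigroup S] : ArrowGroupoid (LeFilter S) where
  src U := U.inverse.prod U
  tgt U := U.prod U.inverse
  mul T U _ := T.prod U
  inv U := U.inverse
  src_src U := by
    simp only [inverse_prod, inverse_inverse, prod_assoc, prod_inverse_prod]
  tgt_src U := by
    simp only [inverse_prod, inverse_inverse, prod_assoc, prod_inverse_prod]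
  src_tgt U := by
    simp only [inverse_prod, inverse_inverse, prod_assoc, inverse_prod_inverse]
  tgt_tgt U := by
    simp only [inverse_prod, inverse_inverse, prod_assoc, inverse_prod_inverse]
  src_mul T U H := by
    rw [inverse_prod, prod_assoc, ← prod_assoc T.inverse, H, prod_assoc, prod_inverse_prod]
  tgt_mul T U H := by
    rw [inverse_prod, prod_assoc, ← prod_assoc U, ← H, prod_assoc, inverse_prod_inverse]
  mul_src U := prod_inverse_prod U
  tgt_mul_self U := by rw [prod_assoc, prod_inverse_prod]
  assoc T U V _ _ := prod_assoc T U V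
  src_inv U := by rw [inverse_inverse]
  tgt_inv U := by rw [inverse_inverse]
  inv_mul _ := rfl
  mul_inv _ := rfl

/-! ### The `≺`-ultrafilters -/

section Ultrafilters

variable (S : Type*) [InverseSemigroupWithZero S]

/-- Every `≺`-filter is a `≤`-filter, so that `precUltrafilters` below misses no
`≺`-ultrafilter. -/
theorem isRelFilter_le_of_ratherBelow {U : Set S}
    (hU : IsRelFilter (fun a b : S => RatherBelow a b) U) :
    IsRelFilter (fun a b : S => a ≤ b) U := by
  refine ⟨hU.nonempty, ?_, ?_⟩
  · intro u v hu huv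
    obtain ⟨w, hw, h, -⟩ := hU.directed hu hu
    refine hU.closed hw ⟨h.1.trans huv, fun c hc => ?_⟩
    obtain ⟨a', ha', ⟨d, hd, hd'⟩, h2⟩ := h.2 c (huv.trans hc)
    exact ⟨a', ha', ⟨d, hd, hc.trans (h2 d hd hd')⟩, fun e h3 h4 => h2 e h3 (huv.trans h4)⟩
  · intro u v hu hv
    obtain ⟨w, hw, h1, h2⟩ := hU.directed hu hv
    exact ⟨w, hw, h1.1, h2.1⟩

/-- The set of all `≺`-ultrafilters. -/
def precUltrafilters : Set (LeFilter S) :=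
  {U | IsRelUltrafilter (fun a b : S => RatherBelow a b) U.carrier}

variable {S} in
/-- The set `O_a` of all `≺`-ultrafilters containing `a`. -/
def basicOpen (a : S) : Set (precUltrafilters S) :=
  {U | a ∈ U.1.carrier}

/-- The topology of the `≺`-ultrafilter space is generated by the sets `O_a`. -/
instance : TopologicalSpace (precUltrafilters S) :=
  TopologicalSpace.generateFrom (range basicOpen)

end Ultrafilters

end UltrafilterGroupoid

open UltrafilterGroupoid

/-!
The order-theoretic facts about `≺` come first; the topology and the groupoid structure rest
on them.

*Order.* In a basic semigroup every principal ideal is a distributive lattice: meets of bounded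
pairs are given by `a * (b⁻¹ * b)`, joins exist by hypothesis, and distributivity follows from
`≺`-distributivity. The defining condition of `a ≺ b` quantifies over all `c ≥ b`. The key
observation, `IsBasicPoset.ratherBelow_of_compl`, is that one `c` is enough: if `a ≺ c` and
`c = f ∨ b` with `f` disjoint from `a`, then `a ≺ b`. Here `≺`-distributivity plays the role of
compactness. As a consequence `≺` is compatible with bounded meets, it agrees with `≺≺`, and left
multiplication by `c` preserves it below the source of `c`. Ultrafilters through `x` can be
studied inside the lattice of elements below `x`; there they are prime, prime filters generate
ultrafilters, and distinct ultrafilters contain disjoint elements.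

*Topology.* Hence each `O_a` is Hausdorff, `O_{a ∨ b} = O_a ∪ O_b`, and `O_a ⊆ O_b` if and only if
`a ≤ b`. If `b ≺ a`, an ultrafilter of subsets of the space that contains `O_b` determines a prime
filter below `a` and so converges to a point of `O_a`; therefore the closure of `O_b` relative to
`O_a` is compact.

*Groupoid.* A filter `T` carries an ultrafilter `U` to an ultrafilter `T U` as soon as `T⁻¹ T` is
contained in `U U⁻¹` (`prod_mem_precUltrafilters`). For ultrafilters `T` this shows closure under
products; for the principal filter of `a⁻¹` it yields the factorization behind
`O_{ab} = O_a · O_b`. The source map is injective on `O_a` with image `O_{a⁻¹a}`, which makes the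
groupoid étale.

*Unions.* A compact bi-Hausdorff bisection has, by the tube lemma, an open neighbourhood `N` that
is still a Hausdorff bisection. If `O_a, O_b ⊆ N` then `a ≃ b`, so in a `≃`-basic semigroup the
elements `f` with `f ≺ e` for some `O_e ⊆ N` are directed, and compactness provides a single `f`
whose set `O_f` contains the given bisection. Bounded pairs have joins, which finishes the
argument.
-/

namespace UltrafilterGroupoid

/-! ### The rather below relation in posets whose principal ideals are lattices -/

section Poset

variable {P : Type*} [PartialOrder P] [OrderBot P] {a a' b b' c f x : P}

theorem RatherBelow.le (h : RatherBelow a b) : a ≤ b := h.1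

theorem RatherBelow.mono_left (h : RatherBelow a b) (ha : a' ≤ a) : RatherBelow a' b := by
  refine ⟨ha.trans h.1, fun c hc => ?_⟩
  obtain ⟨f, hf, h'⟩ := h.2 c hc
  exact ⟨f, hf.mono_right ha, h'⟩

theorem RatherBelow.mono_right (h : RatherBelow a b) (hb : b ≤ b') : RatherBelow a b' := by
  refine ⟨h.1.trans hb, fun c hc => ?_⟩
  obtain ⟨f, hf, ⟨d, hfd, hbd⟩, h'⟩ := h.2 c (hb.trans hc)
  exact ⟨f, hf, ⟨d, hfd, hc.trans (h' d hfd hbd)⟩, fun e hfe hbe => h' e hfe (hb.trans hbe)⟩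

theorem bot_ratherBelow : RatherBelow (⊥ : P) a :=
  ⟨bot_le, fun c hc => ⟨c, disjoint_bot_right, ⟨c, le_rfl, hc⟩, fun _ h _ => h⟩⟩

variable (P) in
/-- A `≺`-distributive poset in which bounded pairs have both a join and a meet. This is what the
order-theoretic part of the argument needs to know about a basic semigroup. -/
structure IsBasicPoset : Prop where
  distributive : PrecDistributive P
  joins : ConditionalJoinSemilattice P
  meets : ∀ a b c : P, a ≤ c → b ≤ c → ∃ m, IsGLB {a, b} m

namespace IsBasicPoset

/-- `≺`-distributivity for a join of two rather smaller elements. -/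
theorem exists_split (hP : IsBasicPoset P) {j : P} (hj : IsLUB {b, c} j) (ha : a ≤ j)
    (h : RatherBelow a' a) :
    ∃ b' c' j', RatherBelow b' b ∧ RatherBelow c' c ∧ IsLUB {b', c'} j' ∧ RatherBelow a' j' ∧
      RatherBelow j' a :=
  (hP.distributive a b c j hj).1 ha a' h

theorem exists_between (hP : IsBasicPoset P) (h : RatherBelow a b) :
    ∃ c, RatherBelow a c ∧ RatherBelow c b := by
  obtain ⟨-, -, j, -, -, -, h1, h2⟩ :=
    hP.exists_split (b := b) (c := b) (j := b) (by simp) le_rfl h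
  exact ⟨j, h1, h2⟩

/-- An element is the supremum of the elements rather below it. -/
theorem le_of_forall_ratherBelow (hP : IsBasicPoset P) (h : ∀ a', RatherBelow a' a → a' ≤ b) :
    a ≤ b := by
  refine (hP.distributive a b b b (by simp)).2 fun a' ha' => ?_
  obtain ⟨m, hm, hma⟩ := hP.exists_between ha'
  obtain ⟨n, hn, hna⟩ := hP.exists_between hma
  have : RatherBelow m b := hn.mono_right (h n hna)
  exact ⟨m, m, m, this, this, by simp, hm, hma⟩

/-- In a basic poset the principal ideals are distributive lattices. -/
noncomputable abbrev distribLatticeIic (hP : IsBasicPoset P) (x : P) : DistribLattice (Iic x) :=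
  letI : Lattice (Iic x) :=
    { (inferInstance : PartialOrder (Iic x)) with
      sup s t := ⟨(hP.joins s t x s.2 t.2).choose,
        (hP.joins s t x s.2 t.2).choose_spec.2 (by
          rintro _ (rfl | rfl)
          exacts [s.2, t.2])⟩
      inf s t := ⟨(hP.meets s t x s.2 t.2).choose,
        ((hP.meets s t x s.2 t.2).choose_spec.1 (by simp)).trans s.2⟩
      le_sup_left s t := (hP.joins s t x s.2 t.2).choose_spec.1 (by simp)
      le_sup_right s t := (hP.joins s t x s.2 t.2).choose_spec.1 (by simp)
      sup_le s t u hs ht := (hP.joins s t x s.2 t.2).choose_spec.2 (by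
        rintro _ (rfl | rfl)
        exacts [hs, ht])
      inf_le_left s t := (hP.meets s t x s.2 t.2).choose_spec.1 (by simp)
      inf_le_right s t := (hP.meets s t x s.2 t.2).choose_spec.1 (by simp)
      le_inf s t u hs ht := (hP.meets t u x t.2 u.2).choose_spec.2 (by
        rintro _ (rfl | rfl)
        exacts [hs, ht]) }
  DistribLattice.ofInfSupLe fun s t u => by
    have hlub : IsLUB {(t : P), (u : P)} ((t ⊔ u : Iic x) : P) :=
      (hP.joins t u x t.2 u.2).choose_spec
    refine hP.le_of_forall_ratherBelow fun a' ha' => ?_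
    obtain ⟨b, c, j, hb, hc, hj, ha'j, hjs⟩ :=
      hP.exists_split hlub (inf_le_right : s ⊓ (t ⊔ u) ≤ t ⊔ u) ha'
    have hjs' : j ≤ s := hjs.le.trans (inf_le_left : s ⊓ (t ⊔ u) ≤ s)
    have hbj : b ≤ j := hj.1 (by simp)
    have hcj : c ≤ j := hj.1 (by simp)
    have hb' : (⟨b, hb.le.trans t.2⟩ : Iic x) ≤ s ⊓ t ⊔ s ⊓ u :=
      le_sup_of_le_left (le_inf (hbj.trans hjs') hb.le)
    have hc' : (⟨c, hc.le.trans u.2⟩ : Iic x) ≤ s ⊓ t ⊔ s ⊓ u :=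
      le_sup_of_le_right (le_inf (hcj.trans hjs') hc.le)
    refine ha'j.le.trans (hj.2 ?_)
    rintro _ (rfl | rfl)
    exacts [hb', hc']

theorem isLUB_sup (hP : IsBasicPoset P) (s t : Iic x) :
    letI := hP.distribLatticeIic x
    IsLUB {(s : P), (t : P)} ((s ⊔ t : Iic x) : P) :=
  (hP.joins s t x s.2 t.2).choose_spec

theorem disjoint_coe_Iic {s t : Iic x} : Disjoint (s : P) t ↔ Disjoint s t := by
  constructor
  · intro h u hs ht
    exact h hs ht
  · intro h u hs ht
    exact h (x := ⟨u, hs.trans s.2⟩) hs ht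

/-- If `a ≺ b ≤ c`, then some `f` that is disjoint from `a` completes `b` to `c`. -/
theorem exists_compl (hP : IsBasicPoset P) (h : RatherBelow a b) (hbc : b ≤ c) :
    ∃ f, Disjoint f a ∧ IsLUB {f, b} c := by
  obtain ⟨f, hf, ⟨d, hfd, hbd⟩, hc⟩ := h.2 c hbc
  let _ := hP.distribLatticeIic d
  let f' : Iic d := ⟨f, hfd⟩
  let b' : Iic d := ⟨b, hbd⟩
  let c' : Iic d := ⟨c, hc d hfd hbd⟩
  have hc' : c' ≤ f' ⊔ b' :=
    hc _ ((hP.isLUB_sup f' b').1 (by simp [f'])) ((hP.isLUB_sup f' b').1 (by simp [b']))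
  refine ⟨(c' ⊓ f' : Iic d), hf.mono_left (inf_le_right : c' ⊓ f' ≤ f'), ?_⟩
  have : c' ⊓ f' ⊔ b' = c' := by
    have hbc' : b' ≤ c' := hbc
    rw [sup_comm, sup_inf_left, sup_comm b' f', inf_eq_left.2, sup_eq_right.2 hbc']
    rwa [sup_eq_right.2 hbc']
  have h2 := hP.isLUB_sup (c' ⊓ f') b'
  rwa [this] at h2

/-- Whether `a ≺ b` holds can be tested on a single upper bound `c` of `b`, as soon as `a ≺ c`: by
`≺`-distributivity, `a` is below `f' ∨ b'` for some `f' ≺ f` and `b' ≺ b`, and `a` avoids `f`. -/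
theorem ratherBelow_of_compl (hP : IsBasicPoset P) (h : RatherBelow a c) (hf : Disjoint f a)
    (hc : IsLUB {f, b} c) :
    RatherBelow a b := by
  obtain ⟨f', b', j, hf', hb', hj, haj, hjc⟩ := hP.exists_split hc le_rfl h
  refine hb'.mono_left ?_
  have hfj : f' ≤ j := hj.1 (by simp)
  have hbj : b' ≤ j := hj.1 (by simp)
  let _ := hP.distribLatticeIic j
  let F : Iic j := ⟨f', hfj⟩
  let B : Iic j := ⟨b', hbj⟩
  let A : Iic j := ⟨a, haj.le⟩
  have h1 : A ≤ F ⊔ B := haj.le.trans (hj.2 (by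
    rintro _ (rfl | rfl)
    exacts [(hP.isLUB_sup F B).1 (by simp [F]), (hP.isLUB_sup F B).1 (by simp [B])]))
  have h2 : Disjoint F A := disjoint_coe_Iic.1 (hf.mono_left hf'.le)
  exact (h2.symm.left_le_of_le_sup_left h1 : A ≤ B)

theorem ratherBelow_inf (hP : IsBasicPoset P) {s t s' t' : Iic x} (h : RatherBelow (s : P) t)
    (h' : RatherBelow (s' : P) t') :
    letI := hP.distribLatticeIic x
    RatherBelow ((s ⊓ s' : Iic x) : P) (t ⊓ t' : Iic x) := by
  let _ := hP.distribLatticeIic x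
  obtain ⟨f, hf, hfx⟩ := hP.exists_compl h t.2
  obtain ⟨f', hf', hfx'⟩ := hP.exists_compl h' t'.2
  let F : Iic x := ⟨f, hfx.1 (by simp)⟩
  let F' : Iic x := ⟨f', hfx'.1 (by simp)⟩
  have e : F ⊔ t = ⊤ := Subtype.ext ((hP.isLUB_sup F t).unique hfx)
  have e' : F' ⊔ t' = ⊤ := Subtype.ext ((hP.isLUB_sup F' t').unique hfx')
  have d : Disjoint F s := disjoint_coe_Iic.1 hf
  have d' : Disjoint F' s' := disjoint_coe_Iic.1 hf'
  refine hP.ratherBelow_of_compl (c := x) (f := (F ⊔ F' : Iic x)) ?_ (disjoint_coe_Iic.2 ?_) ?_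
  · exact (h.mono_right t.2).mono_left (inf_le_left : s ⊓ s' ≤ s)
  · exact disjoint_sup_left.2 ⟨d.mono_right inf_le_left, d'.mono_right inf_le_right⟩
  · have h3 : F ⊔ F' ⊔ t ⊓ t' = ⊤ := by
      rw [sup_inf_left, sup_right_comm, e, top_sup_eq, sup_assoc, e', sup_top_eq, inf_top_eq]
    have h4 := hP.isLUB_sup (F ⊔ F') (t ⊓ t')
    rwa [h3] at h4

theorem ratherBelow_isLUB (hP : IsBasicPoset P) {j : P} (h : RatherBelow a b)
    (h' : RatherBelow a' b) (hj : IsLUB {a, a'} j) : RatherBelow j b := by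
  have hjb : j ≤ b := hj.2 (by
    rintro _ (rfl | rfl)
    exacts [h.le, h'.le])
  refine ⟨hjb, fun c hc => ?_⟩
  obtain ⟨f, hf, hfx⟩ := hP.exists_compl h hc
  obtain ⟨f', hf', hfx'⟩ := hP.exists_compl h' hc
  let _ := hP.distribLatticeIic c
  let F : Iic c := ⟨f, hfx.1 (by simp)⟩
  let F' : Iic c := ⟨f', hfx'.1 (by simp)⟩
  let A : Iic c := ⟨a, h.le.trans hc⟩
  let A' : Iic c := ⟨a', h'.le.trans hc⟩
  let B : Iic c := ⟨b, hc⟩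
  have e : F ⊔ B = ⊤ := Subtype.ext ((hP.isLUB_sup F B).unique hfx)
  have e' : F' ⊔ B = ⊤ := Subtype.ext ((hP.isLUB_sup F' B).unique hfx')
  have d : Disjoint F A := disjoint_coe_Iic.1 hf
  have d' : Disjoint F' A' := disjoint_coe_Iic.1 hf'
  have hj' : j = (A ⊔ A' : Iic c) := hj.unique (hP.isLUB_sup A A')
  have h3 : F ⊓ F' ⊔ B = ⊤ := by rw [sup_inf_right, e, e', inf_top_eq]
  have h4 := hP.isLUB_sup (F ⊓ F') B
  rw [h3] at h4
  refine ⟨(F ⊓ F' : Iic c), ?_, ⟨c, (F ⊓ F').2, hc⟩, fun u hu hbu => h4.2 ?_⟩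
  · rw [hj']
    exact disjoint_coe_Iic.2
      (disjoint_sup_right.2 ⟨d.mono_left inf_le_left, d'.mono_left inf_le_right⟩)
  · rintro _ (rfl | rfl)
    exacts [hu, hbu]

end IsBasicPoset

end Poset

theorem IsRelFilter.exists_mem_rel {P : Type*} {r : P → P → Prop} {U : Set P}
    (hU : IsRelFilter r U) {u : P} (hu : u ∈ U) : ∃ w ∈ U, r w u := by
  obtain ⟨w, hw, hwu, -⟩ := hU.directed hu hu
  exact ⟨w, hw, hwu⟩

/-! ### Ultrafilters in a distributive lattice with a rather below relation -/

section Lattice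

variable {L : Type*} [DistribLattice L] [BoundedOrder L] {r : L → L → Prop}

/-- The properties of the rather below relation of a basic poset, restricted to the principal ideal
of an element `x`, that govern its ultrafilters. Here `⊤` stands for `x`; `⊤ ≺ ⊤` may fail,
and `s ≺ t` is determined by `s ≺ ⊤` and the complements of `t`. -/
structure IsProximity (r : L → L → Prop) : Prop where
  le : ∀ {s t}, r s t → s ≤ t
  mono : ∀ {s s' t t'}, s' ≤ s → r s t → t ≤ t' → r s' t'
  bot : ∀ s, r ⊥ s
  exists_between : ∀ {s t}, r s t → ∃ u, r s u ∧ r u t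
  inf : ∀ {s t s' t'}, r s t → r s' t' → r (s ⊓ s') (t ⊓ t')
  exists_compl : ∀ {s t}, r s t → ∃ f, Disjoint f s ∧ f ⊔ t = ⊤
  of_compl : ∀ {s t f}, r s ⊤ → Disjoint f s → f ⊔ t = ⊤ → r s t
  exists_split : ∀ {s t u}, r s (t ⊔ u) → ∃ t' u', r t' t ∧ r u' u ∧ s ≤ t' ⊔ u'

/-- The elements that are rather above an element of `F`. -/
def ratherAbove (r : L → L → Prop) (F : Set L) : Set L := {w | ∃ s ∈ F, r s w}

namespace IsProximity

theorem isRelFilter_ratherAbove (hr : IsProximity r) {F : Set L}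
    (hF : ∀ s ∈ F, ∀ t ∈ F, s ⊓ t ∈ F) {b : L} (hb : b ∈ F) (hb' : r b ⊤) :
    IsRelFilter r (ratherAbove r F) := by
  refine ⟨⟨⊤, b, hb, hb'⟩, ?_, ?_⟩
  · rintro u v ⟨s, hs, hsu⟩ huv
    exact ⟨s, hs, hr.mono le_rfl hsu (hr.le huv)⟩
  · rintro u v ⟨s, hs, hsu⟩ ⟨t, ht, htv⟩
    obtain ⟨u', hu1, hu2⟩ := hr.exists_between hsu
    obtain ⟨v', hv1, hv2⟩ := hr.exists_between htv
    exact ⟨u' ⊓ v', ⟨s ⊓ t, hF s hs t ht, hr.inf hu1 hv1⟩, hr.mono inf_le_left hu2 le_rfl,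
      hr.mono inf_le_right hv2 le_rfl⟩

theorem bot_mem_ratherAbove (hr : IsProximity r) {F : Set L} :
    ⊥ ∈ ratherAbove r F ↔ ⊥ ∈ F := by
  constructor
  · rintro ⟨s, hs, h⟩
    rwa [← le_bot_iff.1 (hr.le h)]
  · exact fun h => ⟨⊥, h, hr.bot _⟩

theorem ne_univ_iff (hr : IsProximity r) {U : Set L} (hU : IsRelFilter r U) :
    U ≠ univ ↔ ⊥ ∉ U := by
  rw [not_iff_not]
  constructor
  · rintro rfl
    trivial
  · exact fun h => eq_univ_of_forall fun u => hU.closed h (hr.bot u)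

theorem mem_of_le (hr : IsProximity r) {U : Set L} (hU : IsRelFilter r U) {u v : L} (hu : u ∈ U)
    (h : u ≤ v) : v ∈ U := by
  obtain ⟨w, hw, hwu, -⟩ := hU.directed hu hu
  exact hU.closed hw (hr.mono le_rfl hwu h)

theorem inf_mem (hr : IsProximity r) {U : Set L} (hU : IsRelFilter r U) {u v : L} (hu : u ∈ U)
    (hv : v ∈ U) : u ⊓ v ∈ U := by
  obtain ⟨w, hw, hwu, hwv⟩ := hU.directed hu hv
  exact hr.mem_of_le hU hw (le_inf (hr.le hwu) (hr.le hwv))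

/-- If every element of an ultrafilter `U` lies above an element of a filter base `F` of nonzero
elements, then `F` generates `U`. -/
theorem ratherAbove_eq_of_bot_notMem (hr : IsProximity r) {U F : Set L}
    (hU : IsRelUltrafilter r U) (hF : ∀ s ∈ F, ∀ t ∈ F, s ⊓ t ∈ F)
    (h : ∀ u ∈ U, ∃ s ∈ F, s ≤ u) (h0 : ⊥ ∉ F) : ratherAbove r F = U := by
  have hUF : U ⊆ ratherAbove r F := fun u hu => by
    obtain ⟨w, hw, hwu⟩ := hU.prop.1.exists_mem_rel hu
    obtain ⟨s, hs, hsw⟩ := h w hw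
    exact ⟨s, hs, hr.mono hsw hwu le_rfl⟩
  obtain ⟨u, hu⟩ := hU.prop.1.nonempty
  obtain ⟨s, hs, hsu⟩ := hUF hu
  have hfil := hr.isRelFilter_ratherAbove hF hs (hr.mono le_rfl hsu le_top)
  exact (hU.eq_of_le ⟨hfil, (hr.ne_univ_iff hfil).2 (by rwa [hr.bot_mem_ratherAbove])⟩ hUF).symm

/-- Ultrafilters are prime. -/
theorem mem_or_mem_of_sup_mem (hr : IsProximity r) {U : Set L} (hU : IsRelUltrafilter r U)
    {s t : L} (h : s ⊔ t ∈ U) : s ∈ U ∨ t ∈ U := by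
  have hfil := hU.prop.1
  have h0 : ⊥ ∉ U := (hr.ne_univ_iff hfil).1 hU.prop.2
  have key : ∀ {s s' : L}, r s' s → s ∉ U → ∃ u ∈ U, u ⊓ s' = ⊥ := fun {s s'} hs hsU => by
    by_contra! hne
    refine hsU ?_
    have := hr.ratherAbove_eq_of_bot_notMem (F := (· ⊓ s') '' U) hU ?_ ?_ ?_
    · rw [← this]
      obtain ⟨u, hu⟩ := hfil.nonempty
      exact ⟨u ⊓ s', ⟨u, hu, rfl⟩, hr.mono inf_le_right hs le_rfl⟩
    · rintro _ ⟨u, hu, rfl⟩ _ ⟨v, hv, rfl⟩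
      exact ⟨u ⊓ v, hr.inf_mem hfil hu hv, inf_inf_distrib_right u v s'⟩
    · exact fun u hu => ⟨u ⊓ s', ⟨u, hu, rfl⟩, inf_le_left⟩
    · rintro ⟨u, hu, h⟩
      exact hne u hu h
  obtain ⟨c, hc, hcst⟩ := hfil.exists_mem_rel h
  obtain ⟨s', t', hs', ht', hc'⟩ := hr.exists_split hcst
  by_contra! hst
  obtain ⟨u, hu, hus⟩ := key hs' hst.1
  obtain ⟨v, hv, hvt⟩ := key ht' hst.2
  have hmem := hr.inf_mem hfil (hr.inf_mem hfil hu hv) hc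
  have hle : u ⊓ v ⊓ c ≤ ⊥ := by
    calc u ⊓ v ⊓ c ≤ u ⊓ v ⊓ (s' ⊔ t') := inf_le_inf_left _ hc'
      _ = u ⊓ v ⊓ s' ⊔ u ⊓ v ⊓ t' := inf_sup_left _ _ _
      _ ≤ u ⊓ s' ⊔ v ⊓ t' := sup_le_sup (inf_le_inf_right _ inf_le_left)
          (inf_le_inf_right _ inf_le_right)
      _ = ⊥ := by rw [hus, hvt, sup_bot_eq]
  exact h0 (hr.mem_of_le hfil hmem hle)

/-- A prime filter that contains some `b ≺ ⊤` generates an ultrafilter. -/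
theorem isRelUltrafilter_ratherAbove (hr : IsProximity r) {F : Set L}
    (hF : ∀ s ∈ F, ∀ t ∈ F, s ⊓ t ∈ F) (h0 : ⊥ ∉ F)
    (hprime : ∀ s t, s ⊔ t = ⊤ → s ∈ F ∨ t ∈ F) {b : L} (hb : b ∈ F) (hb' : r b ⊤) :
    IsRelUltrafilter r (ratherAbove r F) := by
  have hfil := hr.isRelFilter_ratherAbove hF hb hb'
  refine ⟨⟨hfil, (hr.ne_univ_iff hfil).2 (by rwa [hr.bot_mem_ratherAbove])⟩, ?_⟩
  rintro V ⟨hV, hV1⟩ hFV w hw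
  have hV0 := (hr.ne_univ_iff hV).1 hV1
  -- A chain `w₃ ≺ w₂ ≺ w₁ ≺ w` in `V`; primeness of `F` is applied to `w₁` and its complement.
  obtain ⟨w₁, hw₁, h₁⟩ := hV.exists_mem_rel hw
  obtain ⟨w₂, hw₂, h₂⟩ := hV.exists_mem_rel hw₁
  obtain ⟨w₃, hw₃, h₃⟩ := hV.exists_mem_rel hw₂
  obtain ⟨f, hf, hfw⟩ := hr.exists_compl h₂
  obtain ⟨g, hg, hgw⟩ := hr.exists_compl h₃
  rcases hprime f w₁ hfw with hfF | hwF
  · -- Here `f ⊓ b ≺ g` although `g` is disjoint from `w₃ ∈ V`, so that `V` would be improper.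
    have hgF : r (f ⊓ b) g := hr.of_compl (hr.mono inf_le_right hb' le_rfl)
      (hf.symm.mono_right inf_le_left) (by rwa [sup_comm])
    have hgV : g ∈ V := hFV ⟨_, hF f hfF b hb, hgF⟩
    have := hr.inf_mem hV hgV hw₃
    rw [hg.eq_bot] at this
    exact absurd this hV0
  · exact ⟨w₁, hwF, h₁⟩

/-- Some ultrafilter avoids a given ideal, provided some `c ≺ ⊤` lies outside that ideal. -/
theorem exists_isRelUltrafilter_disjoint (hr : IsProximity r) (D : Order.Ideal L) {c : L}
    (hc : r c ⊤) (hcD : c ∉ D) :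
    ∃ U, IsRelUltrafilter r U ∧ ⊤ ∈ U ∧ Disjoint U D := by
  obtain ⟨J, hJ, hDJ, hcJ⟩ := DistribLattice.prime_ideal_of_disjoint_filter_ideal
    (F := Order.PFilter.principal c) (I := D) (by
      rw [Set.disjoint_left]
      exact fun s hs hsD => hcD (D.lower hs hsD))
  have hcJ' : c ∉ J := Set.disjoint_left.1 hcJ (show c ∈ Order.PFilter.principal c from le_rfl)
  have hU := hr.isRelUltrafilter_ratherAbove (F := (J : Set L)ᶜ) ?_ ?_ ?_ (b := c) hcJ' hc
  · refine ⟨_, hU, ⟨c, hcJ', hc⟩, Set.disjoint_left.2 ?_⟩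
    rintro w ⟨s, hs, hsw⟩ hw
    exact hs (J.lower (hr.le hsw) (hDJ hw))
  · intro s hs t ht hst
    exact (hJ.mem_or_mem hst).elim hs ht
  · exact fun h => h J.bot_mem
  · intro s t hst
    by_contra! h
    refine hJ.toIsProper.top_notMem ?_
    rw [← hst]
    exact J.sup_mem (not_not.1 h.1) (not_not.1 h.2)

/-- Distinct ultrafilters contain disjoint elements. -/
theorem exists_inf_eq_bot (hr : IsProximity r) {U V : Set L} (hU : IsRelUltrafilter r U)
    (hV : IsRelUltrafilter r V) (hUV : U ≠ V) : ∃ u ∈ U, ∃ v ∈ V, u ⊓ v = ⊥ := by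
  by_contra! h
  have hF : ∀ s ∈ image2 (· ⊓ ·) U V, ∀ t ∈ image2 (· ⊓ ·) U V, s ⊓ t ∈ image2 (· ⊓ ·) U V := by
    rintro _ ⟨u, hu, v, hv, rfl⟩ _ ⟨u', hu', v', hv', rfl⟩
    exact ⟨u ⊓ u', hr.inf_mem hU.prop.1 hu hu', v ⊓ v', hr.inf_mem hV.prop.1 hv hv',
      inf_inf_inf_comm u u' v v'⟩
  have h0 : ⊥ ∉ image2 (· ⊓ ·) U V := by
    rintro ⟨u, hu, v, hv, h'⟩
    exact h u hu v hv h'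
  obtain ⟨u₀, hu₀⟩ := hU.prop.1.nonempty
  obtain ⟨v₀, hv₀⟩ := hV.prop.1.nonempty
  refine hUV ?_
  rw [← hr.ratherAbove_eq_of_bot_notMem hU hF
      (fun u hu => ⟨u ⊓ v₀, ⟨u, hu, v₀, hv₀, rfl⟩, inf_le_left⟩) h0,
    hr.ratherAbove_eq_of_bot_notMem hV hF
      (fun v hv => ⟨u₀ ⊓ v, ⟨u₀, hu₀, v, hv, rfl⟩, inf_le_right⟩) h0]

end IsProximity

end Lattice

/-! ### Ultrafilters in posets whose principal ideals are lattices -/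

section Poset

variable {P : Type*} [PartialOrder P] [OrderBot P] {x : P}

theorem ne_univ_iff_bot_notMem {U : Set P}
    (hU : IsRelFilter (fun a b : P => RatherBelow a b) U) : U ≠ univ ↔ ⊥ ∉ U := by
  rw [not_iff_not]
  constructor
  · rintro rfl
    trivial
  · exact fun h => eq_univ_of_forall fun u => hU.closed h bot_ratherBelow

theorem mem_of_le_of_mem {U : Set P} (hU : IsRelFilter (fun a b : P => RatherBelow a b) U)
    {u v : P} (hu : u ∈ U) (h : u ≤ v) : v ∈ U := by
  obtain ⟨w, hw, hwu⟩ := hU.exists_mem_rel hu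
  exact hU.closed hw (hwu.mono_right h)

/-- The rather below relation between elements of a principal ideal. -/
abbrev IicRatherBelow (x : P) (s t : Iic x) : Prop := RatherBelow (s : P) t

theorem IsBasicPoset.isProximity (hP : IsBasicPoset P) (x : P) :
    letI := hP.distribLatticeIic x
    IsProximity (IicRatherBelow x) := by
  let _ := hP.distribLatticeIic x
  exact
  { le := fun h => h.le
    mono := fun h1 h h2 => (h.mono_left h1).mono_right h2
    bot := fun s => bot_ratherBelow
    exists_between := fun {s t} h => by
      obtain ⟨c, h1, h2⟩ := hP.exists_between h
      exact ⟨⟨c, h2.le.trans t.2⟩, h1, h2⟩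
    inf := fun h h' => hP.ratherBelow_inf h h'
    exists_compl := fun {s t} h => by
      obtain ⟨f, hf, hfx⟩ := hP.exists_compl h t.2
      let F : Iic x := ⟨f, hfx.1 (by simp)⟩
      exact ⟨F, disjoint_coe_Iic.1 hf, Subtype.ext ((hP.isLUB_sup F t).unique hfx)⟩
    of_compl := fun {s t f} hs hf hft => by
      refine hP.ratherBelow_of_compl hs (disjoint_coe_Iic.2 hf) ?_
      have := hP.isLUB_sup f t
      rwa [hft] at this
    exists_split := fun {s t u} h => by
      obtain ⟨t', u', j, ht, hu, hj, hsj, -⟩ := hP.exists_split (hP.isLUB_sup t u) le_rfl h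
      refine ⟨⟨t', ht.le.trans t.2⟩, ⟨u', hu.le.trans u.2⟩, ht, hu, hsj.le.trans (hj.2 ?_)⟩
      have := hP.isLUB_sup ⟨t', ht.le.trans t.2⟩ ⟨u', hu.le.trans u.2⟩
      exact this.1 }

theorem isRelFilter_preimage_coe {U : Set P}
    (hU : IsRelFilter (fun a b : P => RatherBelow a b) U) (hx : x ∈ U) :
    IsRelFilter (IicRatherBelow x) (Subtype.val ⁻¹' U) := by
  refine ⟨⟨⟨x, le_rfl⟩, hx⟩, fun u v hu huv => hU.closed hu huv, fun u v hu hv => ?_⟩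
  obtain ⟨w, hw, hwu, hwv⟩ := hU.directed hu hv
  exact ⟨⟨w, hwu.le.trans u.2⟩, hw, hwu, hwv⟩

theorem isRelFilter_upperClosure_image_coe {V : Set (Iic x)}
    (hV : IsRelFilter (IicRatherBelow x) V) :
    IsRelFilter (fun a b : P => RatherBelow a b)
      (upperClosure (Subtype.val '' V) : Set P) := by
  refine ⟨?_, ?_, ?_⟩
  · obtain ⟨v, hv⟩ := hV.nonempty
    exact ⟨v, v, ⟨v, hv, rfl⟩, le_rfl⟩
  · rintro u v ⟨_, ⟨w, hw, rfl⟩, hwu⟩ huv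
    exact ⟨w, ⟨w, hw, rfl⟩, hwu.trans huv.le⟩
  · rintro u v ⟨_, ⟨w, hw, rfl⟩, hwu⟩ ⟨_, ⟨w', hw', rfl⟩, hwv⟩
    obtain ⟨y, hy, h1, h2⟩ := hV.directed hw hw'
    exact ⟨y, ⟨y, ⟨y, hy, rfl⟩, le_rfl⟩, h1.mono_right hwu, h2.mono_right hwv⟩

theorem top_mem_of_isRelFilter {V : Set (Iic x)} (hV : IsRelFilter (IicRatherBelow x) V) :
    (⟨x, le_rfl⟩ : Iic x) ∈ V := by
  obtain ⟨v, hv⟩ := hV.nonempty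
  obtain ⟨w, hw, hwv⟩ := hV.exists_mem_rel hv
  exact hV.closed hw (RatherBelow.mono_right hwv v.2)

theorem upperClosure_preimage_coe {U : Set P}
    (hU : IsRelFilter (fun a b : P => RatherBelow a b) U) (hx : x ∈ U) :
    (upperClosure (Subtype.val '' (Subtype.val ⁻¹' U : Set (Iic x))) : Set P) = U := by
  ext u
  constructor
  · rintro ⟨_, ⟨w, hw, rfl⟩, hwu⟩
    exact mem_of_le_of_mem hU hw hwu
  · intro hu
    obtain ⟨w, hw, hwu, hwx⟩ := hU.directed hu hx
    exact ⟨w, ⟨⟨w, hwx.le⟩, hw, rfl⟩, hwu.le⟩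

theorem preimage_coe_upperClosure {V : Set (Iic x)} (hV : IsRelFilter (IicRatherBelow x) V) :
    Subtype.val ⁻¹' (upperClosure (Subtype.val '' V) : Set P) = V := by
  ext u
  constructor
  · rintro ⟨_, ⟨w, hw, rfl⟩, hwu⟩
    obtain ⟨y, hy, hyw⟩ := hV.exists_mem_rel hw
    exact hV.closed hy (RatherBelow.mono_right hyw hwu)
  · exact fun hu => ⟨u, ⟨u, hu, rfl⟩, le_rfl⟩

theorem isRelUltrafilter_preimage_coe {U : Set P}
    (hU : IsRelUltrafilter (fun a b : P => RatherBelow a b) U) (hx : x ∈ U) :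
    IsRelUltrafilter (IicRatherBelow x) (Subtype.val ⁻¹' U) := by
  have h0 := (ne_univ_iff_bot_notMem hU.prop.1).1 hU.prop.2
  refine ⟨⟨isRelFilter_preimage_coe hU.prop.1 hx, fun h => h0 ?_⟩, ?_⟩
  · exact (eq_univ_iff_forall.1 h ⟨⊥, bot_le⟩ :)
  · rintro V ⟨hV, hV1⟩ hUV
    have hfil := isRelFilter_upperClosure_image_coe hV
    have hle : U ⊆ (upperClosure (Subtype.val '' V) : Set P) := by
      rw [← upperClosure_preimage_coe hU.prop.1 hx]
      rintro u ⟨_, ⟨w, hw, rfl⟩, hwu⟩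
      exact ⟨w, ⟨w, hUV hw, rfl⟩, hwu⟩
    have := hU.le_of_ge ⟨hfil, ?_⟩ hle
    · intro v hv
      exact this ⟨v, ⟨v, hv, rfl⟩, le_rfl⟩
    · intro h
      refine hV1 ?_
      rw [← preimage_coe_upperClosure hV, h, preimage_univ]

theorem isRelUltrafilter_upperClosure_image_coe {V : Set (Iic x)}
    (hV : IsRelUltrafilter (IicRatherBelow x) V) :
    IsRelUltrafilter (fun a b : P => RatherBelow a b)
      (upperClosure (Subtype.val '' V) : Set P) := by
  have hx : x ∈ (upperClosure (Subtype.val '' V) : Set P) :=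
    ⟨x, ⟨_, top_mem_of_isRelFilter hV.prop.1, rfl⟩, le_rfl⟩
  refine ⟨⟨isRelFilter_upperClosure_image_coe hV.prop.1, fun h => hV.prop.2 ?_⟩, ?_⟩
  · rw [← preimage_coe_upperClosure hV.prop.1, h, preimage_univ]
  · rintro U ⟨hU, hU1⟩ hVU
    have hxU := hVU hx
    have := hV.le_of_ge (y := Subtype.val ⁻¹' U) ⟨isRelFilter_preimage_coe hU hxU, fun h =>
      (ne_univ_iff_bot_notMem hU).1 hU1 (eq_univ_iff_forall.1 h ⟨⊥, bot_le⟩ :)⟩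
      (fun v hv => hVU ⟨v, ⟨v, hv, rfl⟩, le_rfl⟩)
    rw [← upperClosure_preimage_coe hU hxU]
    rintro u ⟨_, ⟨w, hw, rfl⟩, hwu⟩
    exact ⟨w, ⟨w, this hw, rfl⟩, hwu⟩

namespace IsBasicPoset

/-- `≺`-ultrafilters are prime. -/
theorem mem_or_mem_of_isLUB (hP : IsBasicPoset P) {U : Set P}
    (hU : IsRelUltrafilter (fun a b : P => RatherBelow a b) U) {s t j : P}
    (hj : IsLUB {s, t} j) (hjU : j ∈ U) : s ∈ U ∨ t ∈ U := by
  let _ := hP.distribLatticeIic j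
  let S : Iic j := ⟨s, hj.1 (by simp)⟩
  let T : Iic j := ⟨t, hj.1 (by simp)⟩
  refine (hP.isProximity j).mem_or_mem_of_sup_mem (isRelUltrafilter_preimage_coe hU hjU)
    (s := S) (t := T) ?_
  rwa [mem_preimage, (hP.isLUB_sup S T).unique hj]

theorem exists_disjoint (hP : IsBasicPoset P) {U V : Set P}
    (hU : IsRelUltrafilter (fun a b : P => RatherBelow a b) U)
    (hV : IsRelUltrafilter (fun a b : P => RatherBelow a b) V) (hUV : U ≠ V)
    (hxU : x ∈ U) (hxV : x ∈ V) : ∃ u ∈ U, ∃ v ∈ V, Disjoint u v := by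
  let _ := hP.distribLatticeIic x
  obtain ⟨u, hu, v, hv, huv⟩ := (hP.isProximity x).exists_inf_eq_bot
    (isRelUltrafilter_preimage_coe hU hxU) (isRelUltrafilter_preimage_coe hV hxV) (fun h => hUV (by
      rw [← upperClosure_preimage_coe hU.prop.1 hxU, h, upperClosure_preimage_coe hV.prop.1 hxV]))
  exact ⟨u, hu, v, hv, disjoint_coe_Iic.2 (disjoint_iff.2 huv)⟩

/-- The `≺`-ultrafilters determine the order. -/
theorem exists_isRelUltrafilter_of_not_le (hP : IsBasicPoset P) {c y : P} (h : ¬c ≤ y) :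
    ∃ U, IsRelUltrafilter (fun a b : P => RatherBelow a b) U ∧ c ∈ U ∧ y ∉ U := by
  let _ := hP.distribLatticeIic c
  let D : Order.Ideal (Iic c) :=
    { carrier := {d | (d : P) ≤ y}
      lower' := fun d e hed hd => le_trans hed hd
      nonempty' := ⟨⊥, (bot_le : (⊥ : P) ≤ y)⟩
      directed' := fun d hd e he => ⟨d ⊔ e, (hP.isLUB_sup d e).2 (by
        rintro _ (rfl | rfl)
        exacts [hd, he]), le_sup_left, le_sup_right⟩ }
  obtain ⟨b, hb, hby⟩ : ∃ b, RatherBelow b c ∧ ¬b ≤ y := by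
    by_contra! hb
    exact h (hP.le_of_forall_ratherBelow hb)
  obtain ⟨V, hV, htop, hVD⟩ := (hP.isProximity c).exists_isRelUltrafilter_disjoint D
    (c := ⟨b, hb.le⟩) hb hby
  refine ⟨_, isRelUltrafilter_upperClosure_image_coe hV, ⟨c, ⟨_, htop, rfl⟩, le_rfl⟩, fun hy => ?_⟩
  have hfil := isRelFilter_upperClosure_image_coe hV.prop.1
  obtain ⟨w, hw, hwy, hwc⟩ := hfil.directed hy ⟨c, ⟨_, htop, rfl⟩, le_rfl⟩
  have hwV : (⟨w, hwc.le⟩ : Iic c) ∈ V := by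
    rw [← preimage_coe_upperClosure hV.prop.1]
    exact hw
  exact Set.disjoint_left.1 hVD hwV (show w ≤ y from hwy.le)

/-- If `b ≺ a` and `b` belongs to a prime filter `F` of the principal ideal of `a`, then some
`≺`-ultrafilter through `a` is generated by elements of `F`. -/
theorem exists_isRelUltrafilter_of_prime (hP : IsBasicPoset P) {a b : P} (hab : RatherBelow b a)
    {F : Set P} (hb : b ∈ F) (h0 : ⊥ ∉ F)
    (hinf : ∀ s ∈ F, ∀ t ∈ F, s ≤ a → t ≤ a → ∀ m, IsGLB {s, t} m → m ∈ F)
    (hsup : ∀ s t, IsLUB {s, t} a → s ∈ F ∨ t ∈ F) :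
    ∃ U, IsRelUltrafilter (fun a b : P => RatherBelow a b) U ∧ a ∈ U ∧
      ∀ u ∈ U, ∃ s ∈ F, s ≤ u := by
  let _ := hP.distribLatticeIic a
  have hV := (hP.isProximity a).isRelUltrafilter_ratherAbove (F := Subtype.val ⁻¹' F)
    (b := ⟨b, hab.le⟩) ?_ h0 ?_ hb hab
  · refine ⟨_, isRelUltrafilter_upperClosure_image_coe hV,
      ⟨a, ⟨_, top_mem_of_isRelFilter hV.prop.1, rfl⟩, le_rfl⟩, ?_⟩
    rintro u ⟨_, ⟨w, ⟨s, hs, hsw⟩, rfl⟩, hwu⟩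
    exact ⟨s, hs, hsw.le.trans hwu⟩
  · intro s hs t ht
    refine hinf s hs t ht s.2 t.2 _ ⟨?_, fun z hz => ?_⟩
    · rintro _ (rfl | rfl)
      exacts [(inf_le_left : s ⊓ t ≤ s), (inf_le_right : s ⊓ t ≤ t)]
    · have hzs : z ≤ s := hz (by simp)
      have hzt : z ≤ t := hz (by simp)
      exact (le_inf hzs hzt : (⟨z, hzs.trans s.2⟩ : Iic a) ≤ s ⊓ t)
  · intro s t hst
    refine hsup s t ?_
    have := hP.isLUB_sup s t
    rwa [hst] at this

end IsBasicPoset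

end Poset

/-! ### Order and multiplication in an inverse semigroup -/

namespace InverseSemigroup

variable {S : Type*} [InverseSemigroup S] {a b c e : S}

theorem mul_inv_mul_of_le (h : a ≤ b) : a * a⁻¹ * b = a := by
  obtain ⟨e, he, rfl⟩ := h
  calc e * b * (e * b)⁻¹ * b = e * ((b * b⁻¹) * e) * b := by
        rw [InverseSemigroup.mul_inv_rev, idem_inv he]; simp only [mul_assoc]
    _ = (e * e) * (b * b⁻¹ * b) := by
        rw [idem_comm (mul_inv_idem b) he]; simp only [mul_assoc]
    _ = e * b := by rw [he, mul_inv_mul]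

theorem mul_inv_mul_of_le' (h : a ≤ b) : b * (a⁻¹ * a) = a := by
  have := congrArg (·⁻¹) (mul_inv_mul_of_le (inv_le_inv' h))
  simpa only [InverseSemigroup.mul_inv_rev, InverseSemigroup.inv_inv] using this

theorem idem_mul_le (he : e * e = e) (a : S) : e * a ≤ a := ⟨e, he, rfl⟩

theorem mul_idem_le (he : e * e = e) (a : S) : a * e ≤ a :=
  ⟨_, conj_idem he a, mul_idem he a⟩

theorem idem_of_le (he : e * e = e) (h : a ≤ e) : a * a = a := by
  obtain ⟨f, hf, rfl⟩ := h
  exact idem_mul_idem hf he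

theorem inv_mul_le_inv_mul (h : a ≤ b) : a⁻¹ * a ≤ b⁻¹ * b := mul_le_mul'' (inv_le_inv' h) h

theorem mul_inv_le_mul_inv (h : a ≤ b) : a * a⁻¹ ≤ b * b⁻¹ := mul_le_mul'' h (inv_le_inv' h)

theorem idem_mul_of_le (he : e * e = e) (h : a * a⁻¹ ≤ e) : e * a = a := by
  refine le_antisymm (idem_mul_le he a) ?_
  calc a = a * a⁻¹ * a := (mul_inv_mul a).symm
    _ ≤ e * a := mul_le_mul'' h le_rfl

theorem inv_mul_mul_of_le (h : b * b⁻¹ ≤ a⁻¹ * a) : a⁻¹ * (a * b) = b := by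
  rw [← mul_assoc]
  exact idem_mul_of_le (inv_mul_idem a) h

theorem inv_mul_mul_le (a b : S) : a⁻¹ * (a * b) ≤ b := by
  rw [← mul_assoc]
  exact idem_mul_le (inv_mul_idem a) b

theorem mul_inv_mul_le (a b : S) : a * (a⁻¹ * b) ≤ b := by
  rw [← mul_assoc]
  exact idem_mul_le (mul_inv_idem a) b

theorem inv_le_comm (h : a⁻¹ ≤ b) : a ≤ b⁻¹ := by
  simpa only [InverseSemigroup.inv_inv] using inv_le_inv' h

/-- The meet of two elements with a common upper bound. -/
theorem isGLB_mul (ha : a ≤ c) (hb : b ≤ c) : IsGLB {a, b} (a * (b⁻¹ * b)) := by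
  refine ⟨?_, fun z hz => ?_⟩
  · simp only [mem_lowerBounds, mem_insert_iff, mem_singleton_iff, forall_eq_or_imp, forall_eq]
    constructor
    · exact mul_idem_le (inv_mul_idem b) a
    · refine le_trans (le_of_eq ?_) (mul_idem_le (inv_mul_idem a) b)
      calc a * (b⁻¹ * b) = c * ((a⁻¹ * a) * (b⁻¹ * b)) := by
            rw [← mul_assoc c, mul_inv_mul_of_le' ha]
        _ = b * (a⁻¹ * a) := by
            rw [idem_comm (inv_mul_idem a) (inv_mul_idem b), ← mul_assoc c, mul_inv_mul_of_le' hb]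
  · have h1 : z ≤ a := hz (by simp)
    have h2 : z ≤ b := hz (by simp)
    rw [← mul_inv_mul' z]
    exact mul_le_mul'' h1 (inv_mul_le_inv_mul h2)

end InverseSemigroup

section WithZero

open InverseSemigroup

variable {S : Type*} [InverseSemigroupWithZero S] {a b c d f : S}

theorem eq_zero_of_inv_mul (h : a⁻¹ * a ≤ ⊥) : a = ⊥ := by
  rw [← mul_inv_mul' a, le_bot_iff.1 h]
  exact mul_zero a

theorem disjoint_inv (h : Disjoint a b) : Disjoint a⁻¹ b⁻¹ := by
  intro z ha hb
  have h0 : z⁻¹ ≤ ⊥ := h (by simpa only [InverseSemigroup.inv_inv] using inv_le_inv' ha)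
    (by simpa only [InverseSemigroup.inv_inv] using inv_le_inv' hb)
  exact le_bot_iff.2 (eq_zero_of_inv_mul (by
    rw [le_bot_iff.1 h0]
    exact (zero_mul z).le))

/-- Disjoint elements with a common upper bound have disjoint sources. -/
theorem disjoint_inv_mul (hf : f ≤ c) (ha : a ≤ c) (h : Disjoint f a) :
    Disjoint (f⁻¹ * f) (a⁻¹ * a) := by
  intro z hzf hza
  have hz : z * z = z := idem_of_le (inv_mul_idem f) hzf
  have hz' : z * z⁻¹ = z := by rw [idem_inv hz, hz]
  have key : ∀ {g}, g ≤ c → z ≤ g⁻¹ * g → c * z ≤ g := fun {g} hg hzg => by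
    rw [← mul_inv_mul_of_le' hg]
    exact mul_le_mul'' le_rfl hzg
  have h0 : c * z = ⊥ := le_bot_iff.1 (h (key hf hzf) (key ha hza))
  have h1 : f * z ≤ ⊥ := (mul_le_mul'' hf le_rfl).trans h0.le
  rw [← inv_mul_mul_of_le (a := f) (b := z) (by rwa [hz']), le_bot_iff.1 h1]
  exact (mul_zero _).le

theorem disjoint_of_inv_mul (h : Disjoint (f⁻¹ * f) (a⁻¹ * a)) : Disjoint f a := fun _ hf ha =>
  (eq_zero_of_inv_mul (h (inv_mul_le_inv_mul hf) (inv_mul_le_inv_mul ha))).le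

theorem isLUB_inv_mul (h : IsLUB {f, b} c) : IsLUB {f⁻¹ * f, b⁻¹ * b} (c⁻¹ * c) := by
  have hf : f ≤ c := h.1 (by simp)
  have hb : b ≤ c := h.1 (by simp)
  refine ⟨?_, fun d hd => ?_⟩
  · rintro _ (rfl | rfl)
    exacts [inv_mul_le_inv_mul hf, inv_mul_le_inv_mul hb]
  · have h1 : c ≤ c * d := h.2 (by
      rintro _ (rfl | rfl)
      · rw [← mul_inv_mul_of_le' hf]
        exact mul_le_mul'' le_rfl (hd (by simp))
      · rw [← mul_inv_mul_of_le' hb]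
        exact mul_le_mul'' le_rfl (hd (by simp)))
    exact (mul_le_mul'' le_rfl h1).trans (inv_mul_mul_le c d)

theorem IsBasicSemigroup.isBasicPoset (hS : IsBasicSemigroup S) : IsBasicPoset S :=
  ⟨hS.distributive, hS.joins, fun _ _ _ ha hb => ⟨_, isGLB_mul ha hb⟩⟩

theorem RatherBelow.inv (h : RatherBelow a b) : RatherBelow a⁻¹ b⁻¹ := by
  refine ⟨inv_le_inv' h.le, fun c hc => ?_⟩
  obtain ⟨f, hf, ⟨d, hfd, hbd⟩, h'⟩ := h.2 c⁻¹ (inv_le_comm hc)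
  refine ⟨f⁻¹, disjoint_inv hf, ⟨d⁻¹, inv_le_inv' hfd, inv_le_inv' hbd⟩, fun e hfe hbe => ?_⟩
  simpa only [InverseSemigroup.inv_inv] using
    inv_le_inv' (h' e⁻¹ (inv_le_comm hfe) (inv_le_comm hbe))

/-- In a basic semigroup the relations `≺` and `≺≺` coincide. -/
theorem IsBasicSemigroup.ratherBelow_iff_biBelow (hS : IsBasicSemigroup S) :
    RatherBelow a b ↔ BiBelow a b := by
  have hP := hS.isBasicPoset
  constructor
  · intro h
    refine ⟨?_, h.le⟩
    -- Some `c ≥ b` has `b⁻¹b ≺ c⁻¹c`; a complement of `b` in `c` is carried to one of `b⁻¹b` in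
    -- `c⁻¹c`.
    obtain ⟨c, hbc, hc⟩ := hS.round b
    obtain ⟨f, hf, hfc⟩ := hP.exists_compl h hc
    exact hP.ratherBelow_of_compl (hbc.mono_left (inv_mul_le_inv_mul h.le))
      (disjoint_inv_mul (hfc.1 (by simp)) (h.le.trans hc) hf) (isLUB_inv_mul hfc)
  · rintro ⟨h, hab⟩
    refine ⟨hab, fun c hc => ?_⟩
    obtain ⟨g, hg, hgc⟩ := hP.exists_compl h (inv_mul_le_inv_mul hc)
    have hgc' : g ≤ c⁻¹ * c := hgc.1 (by simp)
    have hgg : g * g = g := idem_of_le (inv_mul_idem c) hgc'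
    have hcg : c⁻¹ * (c * g) = g := inv_mul_mul_of_le (by rwa [idem_inv hgg, hgg])
    have hcg' : (c * g)⁻¹ * (c * g) = g := by
      rw [InverseSemigroup.mul_inv_rev, mul_assoc, hcg, idem_inv hgg, hgg]
    refine ⟨c * g, disjoint_of_inv_mul (by rwa [hcg']), ⟨c, mul_idem_le hgg c, hc⟩,
      fun d hgd hbd => ?_⟩
    have h1 : c⁻¹ * c ≤ c⁻¹ * d := hgc.2 (by
      rintro _ (rfl | rfl)
      · exact hcg.ge.trans (mul_le_mul'' le_rfl hgd)
      · exact mul_le_mul'' (inv_le_inv' hc) hbd)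
    calc c = c * (c⁻¹ * c) := (mul_inv_mul' c).symm
      _ ≤ c * (c⁻¹ * d) := mul_le_mul'' le_rfl h1
      _ ≤ d := mul_inv_mul_le c d

theorem IsBasicSemigroup.exists_ratherBelow (hS : IsBasicSemigroup S) (a : S) :
    ∃ b, RatherBelow a b := by
  obtain ⟨b, hb⟩ := hS.round a
  exact ⟨b, hS.ratherBelow_iff_biBelow.2 hb⟩

/-- Left multiplication by `c` preserves `≺` below the source of `c`. -/
theorem IsBasicSemigroup.mul_ratherBelow_mul (hS : IsBasicSemigroup S) (h : RatherBelow a b)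
    (hc : b * b⁻¹ ≤ c⁻¹ * c) : RatherBelow (c * a) (c * b) := by
  rw [hS.ratherBelow_iff_biBelow] at h ⊢
  refine ⟨?_, mul_le_mul'' le_rfl h.2⟩
  have key : ∀ {x}, x * x⁻¹ ≤ c⁻¹ * c → (c * x)⁻¹ * (c * x) = x⁻¹ * x := fun {x} hx => by
    rw [InverseSemigroup.mul_inv_rev, mul_assoc, inv_mul_mul_of_le hx]
  rw [key hc, key ((mul_inv_le_mul_inv h.2).trans hc)]
  exact h.1

end WithZero

/-! ### The groupoid of ultrafilters -/

namespace LeFilter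

open InverseSemigroup

section

variable {S : Type*} [InverseSemigroup S]

/-- The principal filter of an element. -/
def principal (a : S) : LeFilter S where
  carrier := {b | a ≤ b}
  isFilter := ⟨⟨a, le_refl a⟩, fun _ _ h h' => le_trans h h', fun _ _ h h' => ⟨a, le_refl a, h, h'⟩⟩

theorem mem_principal {a b : S} : b ∈ (principal a).carrier ↔ a ≤ b := Iff.rfl

theorem exists_le_le {U : LeFilter S} {u v : S} (hu : u ∈ U.carrier) (hv : v ∈ U.carrier) :
    ∃ w ∈ U.carrier, w ≤ u ∧ w ≤ v := U.isFilter.directed hu hv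

theorem mem_of_le {U : LeFilter S} {u v : S} (hu : u ∈ U.carrier) (h : u ≤ v) : v ∈ U.carrier :=
  U.isFilter.closed hu h

theorem inv_mul_mem {U : LeFilter S} {u : S} (hu : u ∈ U.carrier) :
    u⁻¹ * u ∈ (U.inverse.prod U).carrier :=
  ⟨u⁻¹, by rwa [mem_inverse, InverseSemigroup.inv_inv], u, hu, le_rfl⟩

theorem mem_prod_inverse {U : LeFilter S} {a : S} :
    a ∈ (U.prod U.inverse).carrier ↔ ∃ u ∈ U.carrier, u * u⁻¹ ≤ a := by
  constructor
  · rintro ⟨u, hu, v, hv, h⟩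
    obtain ⟨w, hw, hwu, hwv⟩ := exists_le_le hu hv
    exact ⟨w, hw, (mul_le_mul'' hwu (by
      simpa only [InverseSemigroup.inv_inv] using inv_le_inv' hwv)).trans h⟩
  · rintro ⟨u, hu, h⟩
    exact ⟨u, hu, u⁻¹, by rwa [mem_inverse, InverseSemigroup.inv_inv], h⟩

theorem mem_inverse_prod {U : LeFilter S} {a : S} :
    a ∈ (U.inverse.prod U).carrier ↔ ∃ u ∈ U.carrier, u⁻¹ * u ≤ a := by
  have := mem_prod_inverse (U := U.inverse) (a := a)
  rw [inverse_inverse] at this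
  rw [this]
  constructor
  · rintro ⟨u, hu, h⟩
    exact ⟨u⁻¹, hu, by rwa [InverseSemigroup.inv_inv]⟩
  · rintro ⟨u, hu, h⟩
    exact ⟨u⁻¹, by rwa [mem_inverse, InverseSemigroup.inv_inv],
      by rwa [InverseSemigroup.inv_inv]⟩

/-- Translating a filter by `a⁻¹` and then by `a` gives it back, if it contains an element whose
target is below that of `a`. -/
theorem principal_prod_principal_inv_prod {U : LeFilter S} {a : S}
    (ha : ∃ u ∈ U.carrier, u * u⁻¹ ≤ a * a⁻¹) :
    (principal a).prod ((principal a⁻¹).prod U) = U := by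
  ext c
  constructor
  · rintro ⟨t, ht, x, ⟨t', ht', w, hw, hx⟩, hc⟩
    obtain ⟨u, hu, hua⟩ := ha
    obtain ⟨v, hv, hvw, hvu⟩ := exists_le_le hw hu
    refine mem_of_le hv ?_
    calc v = a * (a⁻¹ * v) := by
            rw [← mul_assoc]
            exact (idem_mul_of_le (mul_inv_idem a) ((mul_inv_le_mul_inv hvu).trans hua)).symm
      _ ≤ t * (t' * w) := mul_le_mul'' ht (mul_le_mul'' ht' hvw)
      _ ≤ t * x := mul_le_mul'' le_rfl hx
      _ ≤ c := hc
  · exact fun hc => ⟨a, le_refl a, a⁻¹ * c, ⟨a⁻¹, le_refl a⁻¹, c, hc, le_rfl⟩, mul_inv_mul_le a c⟩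

theorem inverse_principal (a : S) : (principal a).inverse = principal a⁻¹ := by
  ext c
  exact ⟨fun h => mem_principal.2 (by
      simpa only [InverseSemigroup.inv_inv] using inv_le_inv' (mem_principal.1 h)),
    fun h => inv_le_comm (mem_principal.1 h)⟩

end

variable {S : Type*} [InverseSemigroupWithZero S]

theorem isRelFilter_prod (hS : IsBasicSemigroup S) {T U : LeFilter S}
    (hU : IsRelFilter (fun a b : S => RatherBelow a b) U.carrier)
    (h : ∀ t ∈ T.carrier, ∃ u ∈ U.carrier, u * u⁻¹ ≤ t⁻¹ * t) :
    IsRelFilter (fun a b : S => RatherBelow a b) (T.prod U).carrier := by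
  refine ⟨(T.prod U).isFilter.nonempty, fun c d hc hcd => mem_of_le hc hcd.le, fun c d hc hd => ?_⟩
  obtain ⟨e, ⟨t, ht, u, hu, hte⟩, hec, hed⟩ := exists_le_le hc hd
  obtain ⟨v, hv, hvt⟩ := h t ht
  obtain ⟨y, hy, hyu, hyv⟩ := exists_le_le hu hv
  obtain ⟨z, hz, hzy⟩ := hU.exists_mem_rel hy
  have := (hS.mul_ratherBelow_mul hzy ((mul_inv_le_mul_inv hyv).trans hvt)).mono_right
    ((mul_le_mul'' le_rfl hyu).trans hte)
  exact ⟨t * z, ⟨t, ht, z, hz, le_rfl⟩, this.mono_right hec, this.mono_right hed⟩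

theorem bot_notMem_prod {T U : LeFilter S} (hU : ⊥ ∉ U.carrier)
    (h : ∀ t ∈ T.carrier, ∃ u ∈ U.carrier, u * u⁻¹ ≤ t⁻¹ * t) : ⊥ ∉ (T.prod U).carrier := by
  rintro ⟨t, ht, u, hu, h0⟩
  obtain ⟨v, hv, hvt⟩ := h t ht
  obtain ⟨y, hy, hyu, hyv⟩ := exists_le_le hu hv
  have h1 : t * y ≤ ⊥ := (mul_le_mul'' le_rfl hyu).trans h0
  have h2 : y = ⊥ := by
    rw [← inv_mul_mul_of_le (a := t) (b := y) ((mul_inv_le_mul_inv hyv).trans hvt),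
      le_bot_iff.1 h1]
    exact mul_zero _
  exact hU (h2 ▸ hy)

end LeFilter

section WithZero

open InverseSemigroup LeFilter

variable {S : Type*} [InverseSemigroupWithZero S] {a b : S}

theorem mem_precUltrafilters {U : LeFilter S} : U ∈ precUltrafilters S ↔
    IsRelUltrafilter (fun a b : S => RatherBelow a b) U.carrier := Iff.rfl

theorem bot_notMem_of_mem_precUltrafilters {U : LeFilter S} (hU : U ∈ precUltrafilters S) :
    ⊥ ∉ U.carrier :=
  (ne_univ_iff_bot_notMem (mem_precUltrafilters.1 hU).prop.1).1 (mem_precUltrafilters.1 hU).prop.2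

/-- A filter `T` acts on those ultrafilters `U` for which `U U⁻¹` contains `T⁻¹ T`. Maximality of
`T U` holds because a larger filter `W` can be moved back to `T⁻¹ W`, which contains `U`. -/
theorem prod_mem_precUltrafilters (hS : IsBasicSemigroup S) {T U : LeFilter S}
    (hU : U ∈ precUltrafilters S)
    (h : ∀ t ∈ T.carrier, ∃ u ∈ U.carrier, u * u⁻¹ ≤ t⁻¹ * t) :
    T.prod U ∈ precUltrafilters S := by
  have hU' := mem_precUltrafilters.1 hU
  have hfil := isRelFilter_prod hS hU'.prop.1 h
  refine ⟨⟨hfil, (ne_univ_iff_bot_notMem hfil).2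
    (bot_notMem_prod (bot_notMem_of_mem_precUltrafilters hU) h)⟩, ?_⟩
  rintro W' ⟨hW', hW'1⟩ hle
  have hW'0 := (ne_univ_iff_bot_notMem hW').1 hW'1
  let W : LeFilter S := ⟨W', isRelFilter_le_of_ratherBelow S hW'⟩
  have hTW : ∀ t ∈ T.inverse.carrier, ∃ w ∈ W.carrier, w * w⁻¹ ≤ t⁻¹ * t := by
    intro t ht
    obtain ⟨u, hu⟩ := U.isFilter.nonempty
    refine ⟨t⁻¹ * u, hle ⟨t⁻¹, ht, u, hu, le_rfl⟩, ?_⟩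
    rw [InverseSemigroup.mul_inv_rev, InverseSemigroup.inv_inv, mul_assoc, ← mul_assoc u]
    refine mul_le_mul'' le_rfl (idem_mul_le (mul_inv_idem u) t)
  have hfil' := isRelFilter_prod hS (T := T.inverse) (U := W) hW' hTW
  have hUW : U.carrier ⊆ (T.inverse.prod W).carrier := by
    intro u hu
    obtain ⟨t, ht⟩ := T.isFilter.nonempty
    exact ⟨t⁻¹, by rwa [mem_inverse, InverseSemigroup.inv_inv], t * u,
      hle ⟨t, ht, u, hu, le_rfl⟩, inv_mul_mul_le t u⟩
  have hWU := hU'.le_of_ge ⟨hfil', (ne_univ_iff_bot_notMem hfil').2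
    (bot_notMem_prod (T := T.inverse) (U := W) hW'0 hTW)⟩ hUW
  intro w hw
  obtain ⟨t, ht⟩ := T.isFilter.nonempty
  exact ⟨t, ht, t⁻¹ * w, hWU ⟨t⁻¹, by rwa [mem_inverse, InverseSemigroup.inv_inv], w, hw, le_rfl⟩,
    mul_inv_mul_le t w⟩

theorem isRelFilter_inv {U : Set S} (hU : IsRelFilter (fun a b : S => RatherBelow a b) U) :
    IsRelFilter (fun a b : S => RatherBelow a b) {a | a⁻¹ ∈ U} := by
  refine ⟨?_, fun u v hu huv => hU.closed hu huv.inv, fun u v hu hv => ?_⟩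
  · obtain ⟨u, hu⟩ := hU.nonempty
    exact ⟨u⁻¹, by simpa only [mem_ofPred_eq, InverseSemigroup.inv_inv] using hu⟩
  · obtain ⟨w, hw, hwu, hwv⟩ := hU.directed hu hv
    refine ⟨w⁻¹, by simpa only [mem_ofPred_eq, InverseSemigroup.inv_inv] using hw, ?_, ?_⟩
    · simpa only [InverseSemigroup.inv_inv] using hwu.inv
    · simpa only [InverseSemigroup.inv_inv] using hwv.inv

theorem inverse_mem_precUltrafilters {U : LeFilter S} (hU : U ∈ precUltrafilters S) :
    U.inverse ∈ precUltrafilters S := by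
  have hU' := mem_precUltrafilters.1 hU
  have hbot : (⊥ : S)⁻¹ = ⊥ := idem_inv (mul_zero (0 : S))
  have hfil := isRelFilter_inv hU'.prop.1
  refine ⟨⟨hfil, (ne_univ_iff_bot_notMem hfil).2 fun h => ?_⟩, ?_⟩
  · rw [mem_ofPred_eq, hbot] at h
    exact bot_notMem_of_mem_precUltrafilters hU h
  · rintro V ⟨hV, hV1⟩ hUV
    have hfil' := isRelFilter_inv hV
    have := hU'.le_of_ge (y := {a | a⁻¹ ∈ V}) ⟨hfil', (ne_univ_iff_bot_notMem hfil').2 fun h => ?_⟩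
      (fun u hu => hUV (show u⁻¹⁻¹ ∈ U.carrier by rwa [InverseSemigroup.inv_inv]))
    · exact fun v hv => this (show v⁻¹⁻¹ ∈ V by rwa [InverseSemigroup.inv_inv])
    · rw [mem_ofPred_eq, hbot] at h
      exact (ne_univ_iff_bot_notMem hV).1 hV1 h

theorem isSubgroupoid_precUltrafilters (hS : IsBasicSemigroup S) :
    (lenzGroupoid S).IsSubgroupoid (precUltrafilters S) := by
  refine ⟨fun U hU => inverse_mem_precUltrafilters hU, fun T _ U hU H => ?_⟩
  refine prod_mem_precUltrafilters hS hU fun t ht => mem_prod_inverse.1 ?_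
  rw [show U.prod U.inverse = T.inverse.prod T from H.symm]
  exact inv_mul_mem ht

/-- The groupoid of `≺`-ultrafilters of a basic semigroup. -/
abbrev ultrafilterGroupoid (hS : IsBasicSemigroup S) : ArrowGroupoid (precUltrafilters S) :=
  (lenzGroupoid S).restrict (precUltrafilters S) (isSubgroupoid_precUltrafilters hS)

theorem setInv_basicOpen (hS : IsBasicSemigroup S) (a : S) :
    (ultrafilterGroupoid hS).setInv (basicOpen a) = basicOpen a⁻¹ := by
  ext U
  constructor
  · rintro ⟨V, hV, rfl⟩
    exact show a⁻¹⁻¹ ∈ V.1.carrier by rwa [InverseSemigroup.inv_inv]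
  · intro hU
    exact ⟨(ultrafilterGroupoid hS).inv U, hU, Subtype.ext (inverse_inverse U.1)⟩

/-- `O_{ab} = O_a · O_b`. An ultrafilter `W` through `a * b` factors as `(W V⁻¹) V`, where `V` is
the translate of `W` by `a⁻¹`. -/
theorem basicOpen_mul (hS : IsBasicSemigroup S) (a b : S) :
    basicOpen (a * b) = (ultrafilterGroupoid hS).setMul (basicOpen a) (basicOpen b) := by
  ext W
  constructor
  · intro hW
    have hab : a * b * (a * b)⁻¹ ≤ a * a⁻¹ := by
      rw [InverseSemigroup.mul_inv_rev, mul_assoc, ← mul_assoc b]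
      exact mul_le_mul'' le_rfl (idem_mul_le (mul_inv_idem b) a⁻¹)
    let V : LeFilter S := (principal a⁻¹).prod W.1
    have hV : V ∈ precUltrafilters S := prod_mem_precUltrafilters hS W.2 fun t ht =>
      ⟨a * b, hW, hab.trans (by
        simpa only [InverseSemigroup.inv_inv] using inv_mul_le_inv_mul (mem_principal.1 ht))⟩
    have hsrc : V.inverse.prod V = W.1.inverse.prod W.1 := by
      rw [show V = (principal a⁻¹).prod W.1 from rfl, inverse_prod, inverse_principal,
        InverseSemigroup.inv_inv, prod_assoc, principal_prod_principal_inv_prod ⟨a * b, hW, hab⟩]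
    have hb : b ∈ V.carrier := ⟨a⁻¹, le_refl a⁻¹, a * b, hW, inv_mul_mul_le a b⟩
    have hWV : (lenzGroupoid S).src W.1 = (lenzGroupoid S).tgt V.inverse := by
      change W.1.inverse.prod W.1 = V.inverse.prod V.inverse.inverse
      rw [inverse_inverse, hsrc]
    have hU := (isSubgroupoid_precUltrafilters hS).mul_mem _ W.2 _
      (inverse_mem_precUltrafilters hV) hWV
    refine ⟨⟨W.1.prod V.inverse, hU⟩, ?_, ⟨V, hV⟩, hb, ?_, ?_⟩
    · refine ⟨a * b, hW, (a⁻¹ * (a * b))⁻¹, ?_, ?_⟩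
      · rw [mem_inverse, InverseSemigroup.inv_inv]
        exact ⟨a⁻¹, le_refl a⁻¹, a * b, hW, le_rfl⟩
      · rw [InverseSemigroup.mul_inv_rev, InverseSemigroup.inv_inv, ← mul_assoc]
        exact idem_mul_le (mul_inv_idem _) a
    · refine Subtype.ext ?_
      exact ((lenzGroupoid S).src_mul _ _ hWV).trans ((lenzGroupoid S).src_inv V)
    · refine Subtype.ext ?_
      change (W.1.prod V.inverse).prod V = W.1
      rw [prod_assoc, hsrc, prod_inverse_prod]
  · rintro ⟨T, hT, U, hU, H, rfl⟩
    exact ⟨a, hT, b, hU, le_rfl⟩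

end WithZero

/-! ### The topology of the space of ultrafilters -/

section Topology

open InverseSemigroup LeFilter

variable {S : Type*} [InverseSemigroupWithZero S] {a b c j : S}

theorem mem_basicOpen {U : precUltrafilters S} : U ∈ basicOpen a ↔ a ∈ U.1.carrier := Iff.rfl

theorem basicOpen_mono (h : a ≤ b) : basicOpen a ⊆ basicOpen b := fun _ hU => mem_of_le hU h

theorem isTopologicalBasis_basicOpen :
    TopologicalSpace.IsTopologicalBasis
      (range (basicOpen : S → Set (precUltrafilters S))) where
  exists_subset_inter := by
    rintro _ ⟨a, rfl⟩ _ ⟨b, rfl⟩ U ⟨ha, hb⟩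
    obtain ⟨c, hc, hca, hcb⟩ := exists_le_le (mem_basicOpen.1 ha) (mem_basicOpen.1 hb)
    exact ⟨_, ⟨c, rfl⟩, hc, subset_inter (basicOpen_mono hca) (basicOpen_mono hcb)⟩
  sUnion_eq := eq_univ_of_forall fun U => by
    obtain ⟨a, ha⟩ := U.1.isFilter.nonempty
    exact ⟨_, ⟨a, rfl⟩, ha⟩
  eq_generateFrom := rfl

theorem isOpen_basicOpen (a : S) : IsOpen (basicOpen a) :=
  isTopologicalBasis_basicOpen.isOpen ⟨a, rfl⟩

theorem exists_basicOpen_subset {U : precUltrafilters S} {N : Set (precUltrafilters S)}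
    (hN : IsOpen N) (hU : U ∈ N) : ∃ a ∈ U.1.carrier, basicOpen a ⊆ N := by
  obtain ⟨_, ⟨a, rfl⟩, ha, haN⟩ := isTopologicalBasis_basicOpen.exists_subset_of_mem_open hU hN
  exact ⟨a, ha, haN⟩

theorem disjoint_basicOpen (h : Disjoint a b) : Disjoint (basicOpen a) (basicOpen b) := by
  rw [Set.disjoint_left]
  intro U ha hb
  obtain ⟨c, hc, hca, hcb⟩ := exists_le_le (mem_basicOpen.1 ha) (mem_basicOpen.1 hb)
  exact bot_notMem_of_mem_precUltrafilters U.2 (le_bot_iff.1 (h hca hcb) ▸ hc)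

theorem IsHausdorffSet.mono {X : Type*} [TopologicalSpace X] {A B : Set X}
    (h : IsHausdorffSet B) (hAB : A ⊆ B) : IsHausdorffSet A :=
  fun x hx y hy => h x (hAB hx) y (hAB hy)

theorem isHausdorffSet_basicOpen (hS : IsBasicSemigroup S) (a : S) :
    IsHausdorffSet (basicOpen a) := by
  intro U hU V hV hUV
  obtain ⟨u, hu, v, hv, huv⟩ := hS.isBasicPoset.exists_disjoint (mem_precUltrafilters.1 U.2)
    (mem_precUltrafilters.1 V.2) (fun h => hUV (Subtype.ext (LeFilter.ext h))) hU hV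
  exact ⟨_, _, isOpen_basicOpen u, isOpen_basicOpen v, hu, hv, disjoint_basicOpen huv⟩

/-- `O_a ∪ O_b = O_{a ∨ b}`, because ultrafilters are prime. -/
theorem basicOpen_union (hS : IsBasicSemigroup S) (hj : IsLUB {a, b} j) :
    basicOpen a ∪ basicOpen b = basicOpen j := by
  refine Subset.antisymm (union_subset (basicOpen_mono (hj.1 (by simp)))
    (basicOpen_mono (hj.1 (by simp)))) fun U hU => ?_
  exact hS.isBasicPoset.mem_or_mem_of_isLUB (mem_precUltrafilters.1 U.2) hj hU

theorem exists_mem_precUltrafilters {U : Set S}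
    (hU : IsRelUltrafilter (fun a b : S => RatherBelow a b) U) :
    ∃ V : precUltrafilters S, V.1.carrier = U :=
  ⟨⟨⟨U, isRelFilter_le_of_ratherBelow S hU.prop.1⟩, hU⟩, rfl⟩

/-- The sets `O_a` reflect the order of the semigroup. -/
theorem basicOpen_subset_iff (hS : IsBasicSemigroup S) :
    basicOpen a ⊆ basicOpen b ↔ a ≤ b := by
  refine ⟨fun h => ?_, basicOpen_mono⟩
  by_contra hab
  obtain ⟨U, hU, haU, hbU⟩ := hS.isBasicPoset.exists_isRelUltrafilter_of_not_le hab
  obtain ⟨V, rfl⟩ := exists_mem_precUltrafilters hU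
  exact hbU (h haU)

/-- If `b ≺ a`, then every ultrafilter of subsets of the space that contains `O_b` converges to a
point of `O_a`. The elements `s ≤ a` for which `O_s` belongs to the ultrafilter form a prime filter,
which generates the limit. -/
theorem exists_le_nhds_of_ratherBelow (hS : IsBasicSemigroup S) (h : RatherBelow b a)
    (𝓕 : Ultrafilter (precUltrafilters S)) (hb : basicOpen b ∈ 𝓕) :
    ∃ U ∈ basicOpen a, (𝓕 : Filter (precUltrafilters S)) ≤ 𝓝 U := by
  have ha : basicOpen a ∈ 𝓕 := Filter.mem_of_superset hb (basicOpen_mono h.le)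
  have h0 : ¬basicOpen (⊥ : S) ∈ 𝓕 := fun h0 => by
    obtain ⟨U, hU⟩ := 𝓕.neBot.nonempty_of_mem h0
    exact bot_notMem_of_mem_precUltrafilters U.2 hU
  have hinf : ∀ s, basicOpen s ∈ 𝓕 → ∀ t, basicOpen t ∈ 𝓕 → s ≤ a → t ≤ a →
      ∀ m, IsGLB {s, t} m → basicOpen m ∈ 𝓕 := by
    intro s hs t ht _ _ m hm
    refine Filter.mem_of_superset (Filter.inter_mem hs ht) ?_
    rintro U ⟨hUs, hUt⟩
    obtain ⟨c, hc, hcs, hct⟩ := exists_le_le (mem_basicOpen.1 hUs) (mem_basicOpen.1 hUt)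
    refine mem_of_le hc (hm.2 ?_)
    rintro _ (rfl | rfl)
    exacts [hcs, hct]
  have hsup : ∀ s t, IsLUB {s, t} a → basicOpen s ∈ 𝓕 ∨ basicOpen t ∈ 𝓕 := by
    intro s t hst
    rw [← basicOpen_union hS hst] at ha
    exact Ultrafilter.union_mem_iff.1 ha
  obtain ⟨U, hU, haU, hUF⟩ := hS.isBasicPoset.exists_isRelUltrafilter_of_prime h
    (F := {s | basicOpen s ∈ 𝓕}) hb h0 hinf hsup
  obtain ⟨V, rfl⟩ := exists_mem_precUltrafilters hU
  refine ⟨V, haU, fun N hN => ?_⟩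
  obtain ⟨O, hON, hO, hVO⟩ := mem_nhds_iff.1 hN
  obtain ⟨u, hu, huO⟩ := exists_basicOpen_subset hO hVO
  obtain ⟨s, hs, hsu⟩ := hUF u hu
  exact Filter.mem_of_superset hs ((basicOpen_mono hsu).trans (huO.trans hON))

/-- If `b ≺ a`, then the closure of `O_b` relative to `O_a` is compact. -/
theorem exists_isCompact_of_ratherBelow (hS : IsBasicSemigroup S) (h : RatherBelow b a) :
    ∃ K, IsCompact K ∧ basicOpen b ⊆ K ∧ K ⊆ basicOpen a := by
  refine ⟨closure (basicOpen b) ∩ basicOpen a, ?_,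
    subset_inter subset_closure (basicOpen_mono h.le), inter_subset_right⟩
  obtain ⟨c, hbc, hca⟩ := hS.isBasicPoset.exists_between h
  rw [isCompact_iff_ultrafilter_le_nhds']
  intro 𝓕 h𝓕
  -- The relative closure lies in `O_c` for any `b ≺ c ≺ a`, because a complement of `c` in `a` is
  -- disjoint from `b`.
  have hc : basicOpen c ∈ 𝓕 := by
    refine Filter.mem_of_superset h𝓕 ?_
    rintro U ⟨hUb, hUa⟩
    obtain ⟨f, hf, hfa⟩ := hS.isBasicPoset.exists_compl hbc hca.le
    rw [← basicOpen_union hS hfa] at hUa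
    refine hUa.resolve_left fun hUf => ?_
    obtain ⟨V, hVf, hVb⟩ := mem_closure_iff.1 hUb _ (isOpen_basicOpen f) hUf
    exact Set.disjoint_left.1 (disjoint_basicOpen hf) hVf hVb
  obtain ⟨U, hUa, hU⟩ := exists_le_nhds_of_ratherBelow hS hca 𝓕 hc
  refine ⟨U, ⟨?_, hUa⟩, hU⟩
  rw [← closure_closure, mem_closure_iff_ultrafilter]
  exact ⟨𝓕, Filter.mem_of_superset h𝓕 inter_subset_left, hU⟩

theorem locallyCompactSpace_precUltrafilters (hS : IsBasicSemigroup S) :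
    LocallyCompactSpace (precUltrafilters S) := by
  refine ⟨fun U N hN => ?_⟩
  obtain ⟨O, hON, hO, hUO⟩ := mem_nhds_iff.1 hN
  obtain ⟨a, ha, haO⟩ := exists_basicOpen_subset hO hUO
  obtain ⟨b, hb, hba⟩ := (mem_precUltrafilters.1 U.2).prop.1.exists_mem_rel ha
  obtain ⟨K, hK, hbK, hKa⟩ := exists_isCompact_of_ratherBelow hS hba
  exact ⟨K, Filter.mem_of_superset ((isOpen_basicOpen b).mem_nhds hb) hbK,
    hKa.trans (haO.trans hON), hK⟩

theorem locallyHausdorff_precUltrafilters (hS : IsBasicSemigroup S) :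
    LocallyHausdorff (precUltrafilters S) := fun U => by
  obtain ⟨a, ha⟩ := U.1.isFilter.nonempty
  exact ⟨_, (isOpen_basicOpen a).mem_nhds ha, isHausdorffSet_basicOpen hS a⟩

end Topology

/-! ### The étale structure -/

section Etale

open InverseSemigroup LeFilter

variable {S : Type*} [InverseSemigroupWithZero S] {a b : S}

theorem mem_src_iff (hS : IsBasicSemigroup S) {U : precUltrafilters S} :
    a ∈ ((ultrafilterGroupoid hS).src U).1.carrier ↔ ∃ u ∈ U.1.carrier, u⁻¹ * u ≤ a :=
  mem_inverse_prod

/-- An ultrafilter `U` through `a` is recovered from its source as the upward closure of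
`a (U⁻¹ U)`. -/
theorem src_injOn_basicOpen (hS : IsBasicSemigroup S) (a : S) :
    InjOn (ultrafilterGroupoid hS).src (basicOpen a) := by
  have key : ∀ {U V : precUltrafilters S}, U ∈ basicOpen a → V ∈ basicOpen a →
      (ultrafilterGroupoid hS).src U = (ultrafilterGroupoid hS).src V →
      U.1.carrier ⊆ V.1.carrier := by
    intro U V hU hV h c hc
    obtain ⟨u, hu, hua, huc⟩ := exists_le_le hU hc
    have hsrc : u⁻¹ * u ∈ ((ultrafilterGroupoid hS).src V).1.carrier := by
      rw [← h]
      exact inv_mul_mem hu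
    obtain ⟨v, hv, hvu⟩ := (mem_src_iff hS).1 hsrc
    obtain ⟨w, hw, hwv, hwa⟩ := exists_le_le hv hV
    refine mem_of_le hw ?_
    calc w = a * (w⁻¹ * w) := (mul_inv_mul_of_le' hwa).symm
      _ ≤ a * (u⁻¹ * u) := mul_le_mul'' le_rfl ((inv_mul_le_inv_mul hwv).trans hvu)
      _ = u := mul_inv_mul_of_le' hua
      _ ≤ c := huc
  intro U hU V hV h
  exact Subtype.ext (LeFilter.ext (Subset.antisymm (key hU hV h) (key hV hU h.symm)))

theorem tgt_injOn_basicOpen (hS : IsBasicSemigroup S) (a : S) :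
    InjOn (ultrafilterGroupoid hS).tgt (basicOpen a) := by
  intro U hU V hV h
  have hinv : ∀ {W}, W ∈ basicOpen a → (ultrafilterGroupoid hS).inv W ∈ basicOpen a⁻¹ :=
    fun hW => by
      rw [← setInv_basicOpen hS]
      exact mem_image_of_mem _ hW
  have h1 := congrArg Subtype.val (src_injOn_basicOpen hS a⁻¹ (hinv hU) (hinv hV)
    (by rwa [ArrowGroupoid.src_inv, ArrowGroupoid.src_inv]))
  have h2 : U.1.inverse = V.1.inverse := h1
  exact Subtype.ext (by rw [← inverse_inverse U.1, h2, inverse_inverse])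

theorem src_image_basicOpen (hS : IsBasicSemigroup S) (a : S) :
    (ultrafilterGroupoid hS).src '' basicOpen a = basicOpen (a⁻¹ * a) := by
  ext W
  constructor
  · rintro ⟨U, hU, rfl⟩
    exact inv_mul_mem (mem_basicOpen.1 hU)
  · intro hW
    rw [basicOpen_mul hS] at hW
    obtain ⟨T, hT, U, hU, H, rfl⟩ := hW
    have hT' : (ultrafilterGroupoid hS).inv T ∈ basicOpen a := by
      rw [mem_basicOpen]
      exact mem_inverse.2 hT
    obtain rfl := tgt_injOn_basicOpen hS a hT' hU (((ultrafilterGroupoid hS).tgt_inv T).trans H)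
    exact ⟨_, hU, ((ultrafilterGroupoid hS).src_inv T).trans
      ((ultrafilterGroupoid hS).mul_inv T).symm⟩

theorem continuous_inv_ultrafilterGroupoid (hS : IsBasicSemigroup S) :
    Continuous (ultrafilterGroupoid hS).inv := by
  refine isTopologicalBasis_basicOpen.continuous_iff.2 ?_
  rintro _ ⟨a, rfl⟩
  exact isOpen_basicOpen a⁻¹

theorem continuous_src_ultrafilterGroupoid (hS : IsBasicSemigroup S) :
    Continuous (ultrafilterGroupoid hS).src := by
  refine isTopologicalBasis_basicOpen.continuous_iff.2 ?_
  rintro _ ⟨a, rfl⟩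
  rw [isOpen_iff_forall_mem_open]
  intro U hU
  obtain ⟨u, hu, hua⟩ := (mem_src_iff hS).1 hU
  exact ⟨basicOpen u, fun V hV => (mem_src_iff hS).2 ⟨u, hV, hua⟩, isOpen_basicOpen u, hu⟩

theorem continuous_tgt_ultrafilterGroupoid (hS : IsBasicSemigroup S) :
    Continuous (ultrafilterGroupoid hS).tgt := by
  refine ((continuous_src_ultrafilterGroupoid hS).comp
    (continuous_inv_ultrafilterGroupoid hS)).congr fun U => ?_
  exact (ultrafilterGroupoid hS).src_inv U

theorem isEtale_ultrafilterGroupoid (hS : IsBasicSemigroup S) :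
    (ultrafilterGroupoid hS).IsEtale where
  continuous_inv := continuous_inv_ultrafilterGroupoid hS
  continuous_mul := by
    refine isTopologicalBasis_basicOpen.continuous_iff.2 ?_
    rintro _ ⟨a, rfl⟩
    rw [isOpen_iff_forall_mem_open]
    rintro ⟨⟨T, U⟩, H⟩ ⟨t, ht, u, hu, htu⟩
    refine ⟨Subtype.val ⁻¹' (basicOpen t ×ˢ basicOpen u), ?_,
      ((isOpen_basicOpen t).prod (isOpen_basicOpen u)).preimage continuous_subtype_val, ht, hu⟩
    rintro ⟨⟨T', U'⟩, H'⟩ ⟨hT', hU'⟩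
    exact ⟨t, hT', u, hU', htu⟩
  isLocalHomeomorph_src := by
    rw [isLocalHomeomorph_iff_isOpenEmbedding_restrict]
    intro U
    obtain ⟨a, ha⟩ := U.1.isFilter.nonempty
    refine ⟨_, (isOpen_basicOpen a).mem_nhds ha,
      IsOpenEmbedding.of_continuous_injective_isOpenMap
        ((continuous_src_ultrafilterGroupoid hS).comp continuous_subtype_val)
        (injOn_iff_injective.1 (src_injOn_basicOpen hS a)) ?_⟩
    have hsrc : IsOpenMap (ultrafilterGroupoid hS).src := by
      refine isTopologicalBasis_basicOpen.isOpenMap_iff.2 ?_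
      rintro _ ⟨b, rfl⟩
      rw [src_image_basicOpen]
      exact isOpen_basicOpen _
    exact hsrc.comp (isOpen_basicOpen a).isOpenMap_subtype_val

end Etale

/-! ### Bisections -/

namespace ArrowGroupoid

variable {G : Type*} {Γ : ArrowGroupoid G} {A B : Set G}

theorem src_eq_and_tgt_eq_of_mem_units {g : G} (hg : g ∈ Γ.units) : Γ.src g = g ∧ Γ.tgt g = g := by
  obtain ⟨h, rfl⟩ := hg
  exact ⟨Γ.src_src h, Γ.tgt_src h⟩

/-- The congruence lemma for the partial multiplication, whose definedness proofs depend on the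
factors. -/
theorem mul_congr {g g' h h' : G} (hg : g = g') (hh : h = h') (H : Γ.src g = Γ.tgt h)
    (H' : Γ.src g' = Γ.tgt h') : Γ.mul g h H = Γ.mul g' h' H' := by
  subst hg hh
  rfl

theorem mul_unit {g u : G} (H : Γ.src g = Γ.tgt u) (hu : u ∈ Γ.units) : Γ.mul g u H = g := by
  have h1 : u = Γ.src g := (src_eq_and_tgt_eq_of_mem_units hu).2.symm.trans H.symm
  rw [mul_congr rfl h1 H (Γ.tgt_src g).symm, Γ.mul_src]

/-- If `g * h⁻¹` is a unit, then `g = h`. -/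
theorem eq_of_mul_inv_mem_units {g h : G} (H : Γ.src g = Γ.tgt (Γ.inv h))
    (hu : Γ.mul g (Γ.inv h) H ∈ Γ.units) : g = h := by
  obtain ⟨h1, h2⟩ := src_eq_and_tgt_eq_of_mem_units hu
  rw [Γ.src_mul, Γ.src_inv] at h1
  have h3 : Γ.src (Γ.mul g (Γ.inv h) H) = Γ.tgt h := by rw [Γ.src_mul, Γ.src_inv]
  have h4 : Γ.mul (Γ.mul g (Γ.inv h) H) h h3 = g := by
    rw [Γ.assoc g (Γ.inv h) h H (Γ.src_inv h), mul_unit _ ⟨h, (Γ.inv_mul h).symm⟩]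
  have h5 : Γ.mul (Γ.mul g (Γ.inv h) H) h h3 = h := by
    rw [mul_congr h1.symm rfl h3 (Γ.src_tgt h), Γ.tgt_mul_self]
  exact h4.symm.trans h5

/-- If `g⁻¹ * h` is a unit, then `g = h`. -/
theorem eq_of_inv_mul_mem_units {g h : G} (H : Γ.src (Γ.inv g) = Γ.tgt h)
    (hu : Γ.mul (Γ.inv g) h H ∈ Γ.units) : g = h := by
  obtain ⟨h1, h2⟩ := src_eq_and_tgt_eq_of_mem_units hu
  rw [Γ.tgt_mul, Γ.tgt_inv] at h2
  have h3 : Γ.src g = Γ.tgt (Γ.mul (Γ.inv g) h H) := by rw [Γ.tgt_mul, Γ.tgt_inv]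
  have h4 : Γ.mul g (Γ.mul (Γ.inv g) h H) h3 = g := mul_unit _ hu
  have h5 : Γ.mul g (Γ.mul (Γ.inv g) h H) h3 = h := by
    rw [← Γ.assoc g (Γ.inv g) h (Γ.tgt_inv g).symm H,
      mul_congr ((Γ.mul_inv g).trans ((Γ.src_inv g).symm.trans H)) rfl _ (Γ.src_tgt h),
      Γ.tgt_mul_self]
  exact h4.symm.trans h5

theorem isBisection_iff : Γ.IsBisection B ↔ InjOn Γ.src B ∧ InjOn Γ.tgt B := by
  constructor
  · rintro ⟨h1, h2⟩
    constructor
    · intro g hg h hh hgh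
      have H : Γ.src g = Γ.tgt (Γ.inv h) := by rw [Γ.tgt_inv, hgh]
      exact eq_of_mul_inv_mem_units H (h2 ⟨g, hg, _, ⟨h, hh, rfl⟩, H, rfl⟩)
    · intro g hg h hh hgh
      have H : Γ.src (Γ.inv g) = Γ.tgt h := by rw [Γ.src_inv, hgh]
      exact eq_of_inv_mul_mem_units H (h1 ⟨_, ⟨g, hg, rfl⟩, h, hh, H, rfl⟩)
  · rintro ⟨h1, h2⟩
    constructor
    · rintro _ ⟨_, ⟨g, hg, rfl⟩, h, hh, H, rfl⟩
      obtain rfl := h2 hg hh ((Γ.src_inv g).symm.trans H)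
      exact ⟨g, (Γ.inv_mul g).symm⟩
    · rintro _ ⟨g, hg, _, ⟨h, hh, rfl⟩, H, rfl⟩
      obtain rfl := h1 hg hh (H.trans (Γ.tgt_inv h))
      exact ⟨Γ.tgt g, (Γ.src_tgt g).trans (Γ.mul_inv g).symm⟩

theorem src_mem_setMul {g : G} (hg : g ∈ B) : Γ.src g ∈ Γ.setMul (Γ.setInv B) B :=
  ⟨_, ⟨g, hg, rfl⟩, g, hg, Γ.src_inv g, Γ.inv_mul g⟩

theorem tgt_mem_setMul {g : G} (hg : g ∈ B) : Γ.tgt g ∈ Γ.setMul B (Γ.setInv B) :=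
  ⟨g, hg, _, ⟨g, hg, rfl⟩, (Γ.tgt_inv g).symm, Γ.mul_inv g⟩

theorem setMul_mono {A' B' : Set G} (hA : A ⊆ A') (hB : B ⊆ B') :
    Γ.setMul A B ⊆ Γ.setMul A' B' := by
  rintro _ ⟨g, hg, h, hh, H, rfl⟩
  exact ⟨g, hA hg, h, hB hh, H, rfl⟩

theorem setInv_mono (hA : A ⊆ B) : Γ.setInv A ⊆ Γ.setInv B := image_mono hA

end ArrowGroupoid

/-! ### Unions of basic open sets -/

section Union

open InverseSemigroup LeFilter ArrowGroupoid

variable {S : Type*} [InverseSemigroupWithZero S] {a b c : S}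

/-- If `O_c` consists of units, then `O_c ⊆ O_{c⁻¹c}`, so that `c ≤ c⁻¹c` is idempotent. -/
theorem idem_of_basicOpen_subset_units (hS : IsBasicSemigroup S)
    (h : basicOpen c ⊆ (ultrafilterGroupoid hS).units) : IsIdempotentElem c := by
  have hc : c ≤ c⁻¹ * c := by
    rw [← basicOpen_subset_iff hS]
    intro U hU
    have h1 : (ultrafilterGroupoid hS).src U = U := (src_eq_and_tgt_eq_of_mem_units (h hU)).1
    rw [mem_basicOpen, ← h1]
    exact inv_mul_mem hU
  exact idem_of_le (inv_mul_idem c) hc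

theorem compatible_of_subset (hS : IsBasicSemigroup S) {N : Set (precUltrafilters S)}
    (hN : (ultrafilterGroupoid hS).IsBisection N) (ha : basicOpen a ⊆ N) (hb : basicOpen b ⊆ N) :
    Compatible a b := by
  constructor
  · refine idem_of_basicOpen_subset_units hS ?_
    rw [basicOpen_mul hS, ← setInv_basicOpen hS]
    exact (setMul_mono ha (setInv_mono hb)).trans hN.2
  · refine idem_of_basicOpen_subset_units hS ?_
    rw [basicOpen_mul hS, ← setInv_basicOpen hS]
    exact (setMul_mono (setInv_mono ha) hb).trans hN.1

theorem IsHausdorffSet.eq_of_le_nhds {X : Type*} [TopologicalSpace X] {N : Set X}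
    (hN : IsHausdorffSet N) {x y : X} (hx : x ∈ N) (hy : y ∈ N) {𝓕 : Ultrafilter X}
    (h𝓕x : (𝓕 : Filter X) ≤ 𝓝 x) (h𝓕y : (𝓕 : Filter X) ≤ 𝓝 y) : x = y := by
  by_contra hxy
  obtain ⟨U, V, hU, hV, hxU, hyV, hUV⟩ := hN x hx y hy hxy
  have := Filter.inter_mem (h𝓕x (hU.mem_nhds hxU)) (h𝓕y (hV.mem_nhds hyV))
  rw [hUV.inter_eq] at this
  exact 𝓕.empty_notMem this

theorem IsHausdorffSet.isCompact_inter {X : Type*} [TopologicalSpace X] {K L N : Set X}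
    (hN : IsHausdorffSet N) (hK : IsCompact K) (hL : IsCompact L) (hKN : K ⊆ N) (hLN : L ⊆ N) :
    IsCompact (K ∩ L) := by
  rw [isCompact_iff_ultrafilter_le_nhds'] at *
  intro 𝓕 h𝓕
  obtain ⟨x, hx, h𝓕x⟩ := hK 𝓕 (Filter.mem_of_superset h𝓕 inter_subset_left)
  obtain ⟨y, hy, h𝓕y⟩ := hL 𝓕 (Filter.mem_of_superset h𝓕 inter_subset_right)
  obtain rfl := hN.eq_of_le_nhds (hKN hx) (hLN hy) h𝓕x h𝓕y
  exact ⟨x, ⟨hx, hy⟩, h𝓕x⟩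

/-- A compact set that is covered by a directed family of basic open sets is contained in one of
them. -/
theorem exists_subset_basicOpen {K : Set (precUltrafilters S)} (hK : IsCompact K) {D : Set S}
    (hD : D.Nonempty) (hdir : ∀ d ∈ D, ∀ e ∈ D, ∃ f ∈ D, d ≤ f ∧ e ≤ f)
    (hKD : ∀ U ∈ K, ∃ d ∈ D, d ∈ U.1.carrier) : ∃ d ∈ D, K ⊆ basicOpen d := by
  have : Nonempty D := hD.to_subtype
  obtain ⟨d, hd⟩ := hK.elim_directed_cover (fun d : D => basicOpen (d : S))
    (fun d => isOpen_basicOpen _) (fun U hU => by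
      obtain ⟨d, hd, hdU⟩ := hKD U hU
      exact mem_iUnion.2 ⟨⟨d, hd⟩, hdU⟩) (fun d e => by
      obtain ⟨f, hf, hdf, hef⟩ := hdir d d.2 e e.2
      exact ⟨⟨f, hf⟩, basicOpen_mono hdf, basicOpen_mono hef⟩)
  exact ⟨d, d.2, hd⟩

/-- If `O_a` and `O_b` lie in a common Hausdorff set, then `a ⌣ b`: for `a' ≺ a` and `b' ≺ b`, the
intersection of the relative closures of `O_{a'}` and `O_{b'}` is a compact subset of
`O_a ∩ O_b`. -/
theorem hausdorffRel_of_subset (hS : IsBasicSemigroup S) {N : Set (precUltrafilters S)}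
    (hN : IsHausdorffSet N) (ha : basicOpen a ⊆ N) (hb : basicOpen b ⊆ N) : HausdorffRel a b := by
  have hP := hS.isBasicPoset
  intro a' ha' b' hb'
  obtain ⟨K, hK, haK, hKa⟩ := exists_isCompact_of_ratherBelow hS ha'
  obtain ⟨L, hL, hbL, hLb⟩ := exists_isCompact_of_ratherBelow hS hb'
  have hKL := hN.isCompact_inter hK hL (hKa.trans ha) (hLb.trans hb)
  have key : ∃ d ∈ {d | ∃ e, e ≤ a ∧ e ≤ b ∧ RatherBelow d e}, K ∩ L ⊆ basicOpen d := by
    refine exists_subset_basicOpen hKL ⟨⊥, ⊥, bot_le, bot_le, bot_ratherBelow⟩ ?_ ?_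
    · rintro d ⟨e, hea, heb, hde⟩ d' ⟨e', hea', heb', hde'⟩
      obtain ⟨f, hf⟩ := hP.joins e e' a hea hea'
      have hef : e ≤ f := hf.1 (by simp)
      have hef' : e' ≤ f := hf.1 (by simp)
      obtain ⟨g, hg⟩ := hP.joins d d' f (hde.le.trans hef) (hde'.le.trans hef')
      refine ⟨g, ⟨f, hf.2 ?_, hf.2 ?_, hP.ratherBelow_isLUB (hde.mono_right hef)
        (hde'.mono_right hef') hg⟩, hg.1 (by simp), hg.1 (by simp)⟩
      · rintro _ (rfl | rfl)
        exacts [hea, hea']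
      · rintro _ (rfl | rfl)
        exacts [heb, heb']
    · rintro U ⟨hUK, hUL⟩
      obtain ⟨e, he, hea, heb⟩ :=
        exists_le_le (mem_basicOpen.1 (hKa hUK)) (mem_basicOpen.1 (hLb hUL))
      obtain ⟨d, hd, hde⟩ := (mem_precUltrafilters.1 U.2).prop.1.exists_mem_rel he
      exact ⟨d, ⟨e, hea, heb, hde⟩, hd⟩
  obtain ⟨d, ⟨e, hea, heb, hde⟩, hd⟩ := key
  obtain ⟨c, hdc, hce⟩ := hP.exists_between hde
  refine ⟨c, hce.mono_right hea, hce.mono_right heb, fun c' hca hcb => hdc.mono_left ?_⟩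
  rw [← basicOpen_subset_iff hS]
  exact (subset_inter ((basicOpen_mono hca.le).trans haK)
    ((basicOpen_mono hcb.le).trans hbL)).trans hd

/-- A compact bi-Hausdorff bisection has an open neighbourhood that is a Hausdorff bisection. Every
pair of points of `C` has neighbourhoods that are separated by the source and by the target map, or,
for equal points, that lie in one set `O_a`. -/
theorem exists_isOpen_isBisection (hS : IsBasicSemigroup S) {C : Set (precUltrafilters S)}
    (hC : IsCompact C) (hC1 : (ultrafilterGroupoid hS).IsBiHausdorff C)
    (hC2 : (ultrafilterGroupoid hS).IsBisection C) :
    ∃ N, IsOpen N ∧ C ⊆ N ∧ IsHausdorffSet N ∧ (ultrafilterGroupoid hS).IsBisection N := by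
  have hsrc := continuous_src_ultrafilterGroupoid hS
  have htgt := continuous_tgt_ultrafilterGroupoid hS
  rw [isBisection_iff] at hC2
  let D : Set (precUltrafilters S × precUltrafilters S) := {p | p.1 = p.2 ∨
    (∃ U V, IsOpen U ∧ IsOpen V ∧ p.1 ∈ U ∧ p.2 ∈ V ∧ Disjoint U V) ∧
    (ultrafilterGroupoid hS).src p.1 ≠ (ultrafilterGroupoid hS).src p.2 ∧
    (ultrafilterGroupoid hS).tgt p.1 ≠ (ultrafilterGroupoid hS).tgt p.2}
  have hCD : C ×ˢ C ⊆ interior D := by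
    rintro ⟨x, y⟩ ⟨hx, hy⟩
    by_cases hxy : x = y
    · obtain rfl : x = y := hxy
      obtain ⟨a, ha⟩ := x.1.isFilter.nonempty
      refine mem_interior.2 ⟨basicOpen a ×ˢ basicOpen a, ?_,
        (isOpen_basicOpen a).prod (isOpen_basicOpen a), ha, ha⟩
      rintro ⟨u, v⟩ ⟨hu, hv⟩
      by_cases huv : u = v
      · exact Or.inl huv
      · exact Or.inr ⟨isHausdorffSet_basicOpen hS a u hu v hv huv,
          fun h => huv (src_injOn_basicOpen hS a hu hv h),
          fun h => huv (tgt_injOn_basicOpen hS a hu hv h)⟩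
    · obtain ⟨U, V, hU, hV, hxU, hyV, hUV⟩ := hC1.1 _ (src_mem_setMul hx) _ (src_mem_setMul hy)
        (fun h => hxy (hC2.1 hx hy h))
      obtain ⟨U', V', hU', hV', hxU', hyV', hUV'⟩ := hC1.2 _ (tgt_mem_setMul hx) _
        (tgt_mem_setMul hy) (fun h => hxy (hC2.2 hx hy h))
      refine mem_interior.2 ⟨
        ((ultrafilterGroupoid hS).src ⁻¹' U ∩ (ultrafilterGroupoid hS).tgt ⁻¹' U') ×ˢ
        ((ultrafilterGroupoid hS).src ⁻¹' V ∩ (ultrafilterGroupoid hS).tgt ⁻¹' V'), ?_,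
        ((hU.preimage hsrc).inter (hU'.preimage htgt)).prod
          ((hV.preimage hsrc).inter (hV'.preimage htgt)), ⟨hxU, hxU'⟩, ⟨hyV, hyV'⟩⟩
      rintro ⟨u, v⟩ ⟨⟨hu, hu'⟩, hv, hv'⟩
      refine Or.inr ⟨⟨_, _, hU.preimage hsrc, hV.preimage hsrc, hu, hv, hUV.preimage _⟩,
        hUV.ne_of_mem hu hv, hUV'.ne_of_mem hu' hv'⟩
  obtain ⟨U, V, hU, hV, hCU, hCV, hUV⟩ := generalized_tube_lemma hC hC isOpen_interior hCD
  have hD : ∀ x ∈ U ∩ V, ∀ y ∈ U ∩ V, (x, y) ∈ D := fun x hx y hy =>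
    interior_subset (hUV ⟨hx.1, hy.2⟩)
  refine ⟨U ∩ V, hU.inter hV, subset_inter hCU hCV, fun x hx y hy hxy => ?_,
    isBisection_iff.2 ⟨fun x hx y hy h => ?_, fun x hx y hy h => ?_⟩⟩
  · exact ((hD x hx y hy).resolve_left hxy).1
  · exact (hD x hx y hy).elim id fun h' => absurd h h'.2.1
  · exact (hD x hx y hy).elim id fun h' => absurd h h'.2.2

/-- In a `≃`-basic semigroup, every compact subset of an open Hausdorff bisection `N` lies in some
`O_f`: the elements `f` with `f ≺ e` for some `O_e ⊆ N` are directed, because `O_e, O_{e'} ⊆ N`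
implies `e ≃ e'`. -/
theorem exists_subset_basicOpen_of_isBisection (hS : IsBasicSemigroup S)
    (hS' : IsSimeqBasicSemigroup S) {C N : Set (precUltrafilters S)} (hC : IsCompact C)
    (hN : IsOpen N) (hCN : C ⊆ N) (hN1 : IsHausdorffSet N)
    (hN2 : (ultrafilterGroupoid hS).IsBisection N) : ∃ f, C ⊆ basicOpen f := by
  have hP := hS.isBasicPoset
  have hjoin : ∀ {d d' e e' : S}, RatherBelow d e → basicOpen e ⊆ N → RatherBelow d' e' →
      basicOpen e' ⊆ N → ∃ j, IsLUB {d, d'} j := fun {d d' e e'} hd he hd' he' =>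
    (hS'.joins d d').2 ⟨e, e', hS.ratherBelow_iff_biBelow.1 hd,
      ⟨compatible_of_subset hS hN2 he he', hausdorffRel_of_subset hS hN1 he he'⟩,
      hS.ratherBelow_iff_biBelow.1 hd'⟩
  have key : ∃ f ∈ {d | ∃ e, RatherBelow d e ∧ basicOpen e ⊆ N}, C ⊆ basicOpen f := by
    refine exists_subset_basicOpen hC ⟨⊥, ⊥, bot_ratherBelow, ?_⟩ ?_ ?_
    · exact fun U hU => absurd hU (bot_notMem_of_mem_precUltrafilters U.2)
    · rintro d ⟨e, hde, he⟩ d' ⟨e', hde', he'⟩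
      obtain ⟨g, hdg, hge⟩ := hP.exists_between hde
      obtain ⟨g', hdg', hge'⟩ := hP.exists_between hde'
      obtain ⟨k, hk⟩ := hjoin hge he hge' he'
      have hgk : g ≤ k := hk.1 (by simp)
      have hgk' : g' ≤ k := hk.1 (by simp)
      obtain ⟨j, hj⟩ := hP.joins d d' k (hdg.le.trans hgk) (hdg'.le.trans hgk')
      refine ⟨j, ⟨k, hP.ratherBelow_isLUB (hdg.mono_right hgk) (hdg'.mono_right hgk') hj, ?_⟩,
        hj.1 (by simp), hj.1 (by simp)⟩
      rw [← basicOpen_union hS hk]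
      exact union_subset ((basicOpen_mono hge.le).trans he) ((basicOpen_mono hge'.le).trans he')
    · intro U hU
      obtain ⟨e, he, heN⟩ := exists_basicOpen_subset hN (hCN hU)
      obtain ⟨d, hd, hde⟩ := (mem_precUltrafilters.1 U.2).prop.1.exists_mem_rel he
      exact ⟨d, ⟨e, hde, heN⟩, hd⟩
  obtain ⟨f, -, hf⟩ := key
  exact ⟨f, hf⟩

theorem isBisection_basicOpen (hS : IsBasicSemigroup S) (a : S) :
    (ultrafilterGroupoid hS).IsBisection (basicOpen a) :=
  isBisection_iff.2 ⟨src_injOn_basicOpen hS a, tgt_injOn_basicOpen hS a⟩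

theorem isBiHausdorff_basicOpen (hS : IsBasicSemigroup S) (a : S) :
    (ultrafilterGroupoid hS).IsBiHausdorff (basicOpen a) := by
  rw [ArrowGroupoid.IsBiHausdorff, setInv_basicOpen hS, ← basicOpen_mul hS, ← basicOpen_mul hS]
  exact ⟨isHausdorffSet_basicOpen hS _, isHausdorffSet_basicOpen hS _⟩

theorem isUnionEtaleBasis_basicOpen (hS : IsBasicSemigroup S) (hS' : IsSimeqBasicSemigroup S) :
    (ultrafilterGroupoid hS).IsUnionEtaleBasis
      (range (basicOpen : S → Set (precUltrafilters S))) where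
  isBasis := isTopologicalBasis_basicOpen
  inv_mem := by
    rintro _ ⟨a, rfl⟩
    exact ⟨a⁻¹, (setInv_basicOpen hS a).symm⟩
  mul_mem := by
    rintro _ ⟨a, rfl⟩ _ ⟨b, rfl⟩
    exact ⟨a * b, basicOpen_mul hS a b⟩
  union_mem_iff := by
    rintro _ ⟨a, rfl⟩ _ ⟨b, rfl⟩
    constructor
    · rintro ⟨c, hc⟩
      obtain ⟨d, hd⟩ := hS.exists_ratherBelow c
      obtain ⟨K, hK, hcK, hKd⟩ := exists_isCompact_of_ratherBelow hS hd
      have hbi := isBiHausdorff_basicOpen hS d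
      have hbis := isBisection_basicOpen hS d
      have hinv := setInv_mono (Γ := ultrafilterGroupoid hS) hKd
      have h1 := setMul_mono (Γ := ultrafilterGroupoid hS) hinv hKd
      have h2 := setMul_mono (Γ := ultrafilterGroupoid hS) hKd hinv
      exact ⟨K, hK, ⟨hbi.1.mono h1, hbi.2.mono h2⟩, ⟨h1.trans hbis.1, h2.trans hbis.2⟩,
        hc ▸ hcK⟩
    · rintro ⟨C, hC, hC1, hC2, habC⟩
      obtain ⟨N, hN, hCN, hN1, hN2⟩ := exists_isOpen_isBisection hS hC hC1 hC2
      obtain ⟨f, hf⟩ := exists_subset_basicOpen_of_isBisection hS hS' hC hN hCN hN1 hN2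
      have habf := union_subset_iff.1 (habC.trans hf)
      obtain ⟨j, hj⟩ := hS.joins a b f ((basicOpen_subset_iff hS).1 habf.1)
        ((basicOpen_subset_iff hS).1 habf.2)
      exact ⟨j, (basicOpen_union hS hj).symm⟩

end Union

end UltrafilterGroupoid

theorem mainTheorem3 {S : Type*} [InverseSemigroupWithZero S] (hS : IsBasicSemigroup S) :
    ∃ hG : (lenzGroupoid S).IsSubgroupoid (precUltrafilters S),
      LocallyCompactSpace (precUltrafilters S) ∧
      LocallyHausdorff (precUltrafilters S) ∧
      ((lenzGroupoid S).restrict (precUltrafilters S) hG).IsEtale ∧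
      (∀ a : S, ((lenzGroupoid S).restrict (precUltrafilters S) hG).setInv (basicOpen a) =
        basicOpen a⁻¹) ∧
      (∀ a b : S, basicOpen (a * b) =
        ((lenzGroupoid S).restrict (precUltrafilters S) hG).setMul
          (basicOpen a) (basicOpen b)) ∧
      (IsSimeqBasicSemigroup S →
        ((lenzGroupoid S).restrict (precUltrafilters S) hG).IsUnionEtaleBasis
          (Set.range (basicOpen : S → Set (precUltrafilters S)))) :=
  ⟨isSubgroupoid_precUltrafilters hS, locallyCompactSpace_precUltrafilters hS,
    locallyHausdorff_precUltrafilters hS, isEtale_ultrafilterGroupoid hS, setInv_basicOpen hS,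
    basicOpen_mul hS, isUnionEtaleBasis_basicOpen hS⟩
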